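/- Let $\xi(s)=(s-1)\pi^{-s/2}\zeta(s)\Gamma(1+s/2)$ (with $\xi(1)=\tfrac12$ by continuity), let $s=\sigma+it$ with $0\le\sigma\le1$, and for real $c$ put $$J(s,c)=\int_{-\infty}^{\infty}\pi^{c-iv}\,\zeta(-2c+2iv-2)\,\Gamma(-c+iv)\,M(c,s,v)\,dv,$$ $$M(c,s,v)=\frac{-(2s-1)^2/2+2iv-2(c+5/4)}{-(2s-1)^2/4+2i\,(2iv-4(c+5/4))\,v+4(c+5/4)^2}.$$ Let also $$G_s(w)=\frac{2is(s-\frac12)\,\Gamma(-w)\pi^{w}\zeta(-2w-2)}{(-3+s-2w)(s+2+2w)}-\frac i2\,\frac{\Gamma(-w)\pi^{w}\zeta(-2w-2)}{s/2+1+w},\qquad K(s,c)=\int_{c-i\infty}^{c+i\infty}G_s(w)\,dw .$$ The lines $c=-\tfrac32$, $c=-\tfrac\sigma2-1$, $c=\tfrac\sigma2-\tfrac32$ bound, in the part $0\le\sigma\le1$, $c>-\tfrac32$ of the $(\sigma,c)$ plane, the following regions (lines excluded): II: $c<-\tfrac\sigma2-1$ and $c<\tfrac\sigma2-\tfrac32$;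 III: $-\tfrac\sigma2-1<c<\tfrac\sigma2-\tfrac32$; IV: $c>-\tfrac\sigma2-1$ and $c>\tfrac\sigma2-\tfrac32$; V: $\tfrac\sigma2-\tfrac32<c<-\tfrac\sigma2-1$. (a) For every real $c$ such that $(\sigma,c)$ is on none of the three lines, the integral $J(s,c)$ converges absolutely and $K(s,c)=-J(s,c)$. (b) If $s\notin\{0,\tfrac12,1\}$, then $G_s$ has at $w=-\tfrac32$, $w=-\tfrac s2-1$ and $w=\tfrac{s-3}2$ isolated singularities with residues $$\rho_1=\frac1{2\pi i},\qquad \rho_2=\frac{i\,\xi(s)}{2\pi},\qquad \rho_3=\tfrac14\, i s(s-1)\,\pi^{(s-3)/2}\,\zeta(1-s)\,\Gamma\!\left(\tfrac{1-s}2\right),$$ and for all $c_1<-\tfrac32$ one has $K(s,c_1)=K(s,c)-2\pi i\,\rho$, where $\rho=\rho_1$, $\rho_1+\rho_2$, $\rho_1+\rho_3$, $\rho_1+\rho_2+\rho_3$ for $(\sigma,c)$ in region II, III, V, IV respectively. (c) For every real $c$: $$\xi(s)=\frac{\pi^{1/4}}{2\Gamma(3/4)}-1-J(s,c)\quad\text{if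 }(\sigma,c)\text{ is in region II},$$ $$0=\frac{\pi^{1/4}}{2\Gamma(3/4)}-1-J(s,c)\quad\text{if }(\sigma,c)\text{ is in region III or V},$$ $$-\xi(s)=\frac{\pi^{1/4}}{2\Gamma(3/4)}-1-J(s,c)\quad\text{if }(\sigma,c)\text{ is in region IV}.$$ -/

import Mathlib

noncomputable section

namespace XiContour

open Complex Filter Topology MeasureTheory

/-- The product `(s - 1) π^{-s/2} ζ(s) Γ(1 + s/2)` (it has a removable singularity at `s = 1`). -/
def xiProduct (s : ℂ) : ℂ :=
  (s - 1) * (Real.pi : ℂ) ^ (-s / 2) * riemannZeta s * Complex.Gamma (1 + s / 2)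

/-- Riemann's `ξ` on the closed critical strip.  The only singularity of the defining product
there is the removable one at `s = 1`, where the value is the limit `1 / 2`
(see `tendsto_xiProduct_one`). -/
def xi (s : ℂ) : ℂ := if s = 1 then 1 / 2 else xiProduct s

theorem tendsto_xiProduct_one : Tendsto xiProduct (𝓝[≠] 1) (𝓝 (1 / 2)) := by
  have hpi : (Real.pi : ℂ) ≠ 0 := by exact_mod_cast Real.pi_ne_zero
  have h1 : ContinuousAt (fun s : ℂ => (Real.pi : ℂ) ^ (-s / 2) * Complex.Gamma (1 + s / 2)) 1 := by
    apply ContinuousAt.mul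
    · exact ContinuousAt.const_cpow (by fun_prop) (Or.inl hpi)
    · have hg : ContinuousAt Complex.Gamma (1 + (1 : ℂ) / 2) := by
        apply (Complex.differentiableAt_Gamma _ _).continuousAt
        intro m hm
        have := congrArg Complex.re hm
        simp at this
        have hm0 : (0 : ℝ) ≤ m := m.cast_nonneg
        norm_num at this
        linarith
      exact ContinuousAt.comp (f := fun s : ℂ => 1 + s / 2) hg (by fun_prop)
  have h2 := riemannZeta_residue_one.mul (h1.tendsto.mono_left nhdsWithin_le_nhds)
  have hv : (1 : ℂ) * ((Real.pi : ℂ) ^ (-(1 : ℂ) / 2) * Complex.Gamma (1 + 1 / 2)) = 1 / 2 := by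
    rw [add_comm, Complex.Gamma_add_one _ (by norm_num), Complex.Gamma_one_half_eq, neg_div,
      Complex.cpow_neg]
    have : (Real.pi : ℂ) ^ (1 / 2 : ℂ) ≠ 0 := by simp [Complex.cpow_eq_zero_iff, hpi]
    field_simp
  rw [hv] at h2
  refine h2.congr fun s => ?_
  simp only [xiProduct]
  ring

/-- The transfer function `M(c, s, v)`. -/
def transferM (c : ℝ) (s : ℂ) (v : ℝ) : ℂ :=
  (-(2 * s - 1) ^ 2 / 2 + 2 * I * v - 2 * (c + 5 / 4)) /
    (-(2 * s - 1) ^ 2 / 4 + 2 * I * (2 * I * v - 4 * (c + 5 / 4)) * v + 4 * (c + 5 / 4) ^ 2)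

/-- The integrand of `J(s, c)`. -/
def JIntegrand (s : ℂ) (c v : ℝ) : ℂ :=
  (Real.pi : ℂ) ^ ((c : ℂ) - I * v) * riemannZeta (-2 * c + 2 * I * v - 2) *
    Complex.Gamma (-c + I * v) * transferM c s v

/-- `J(s, c)`, an integral over the real line. -/
def J (s : ℂ) (c : ℝ) : ℂ := ∫ v : ℝ, JIntegrand s c v

/-- The constant `π^{1/4} / (2 Γ(3/4))`. -/
def A : ℝ := Real.pi ^ (1 / 4 : ℝ) / (2 * Real.Gamma (3 / 4))

/-- The integrand, in the complex variable `w`, of the two contour integrals of the integral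
equation `ξ(s) = A + ∫_{Re w = c} kernel s w dw`, `c < -3/2`. -/
def kernel (s w : ℂ) : ℂ :=
  2 * I * s * (s - 1 / 2) *
      (Complex.Gamma (-w) * (Real.pi : ℂ) ^ w * riemannZeta (-2 * w - 2) /
        ((-3 + s - 2 * w) * (s + 2 + 2 * w))) -
    I / 2 * (Complex.Gamma (-w) * (Real.pi : ℂ) ^ w * riemannZeta (-2 * w - 2) /
        (s / 2 + 1 + w))

/-- `∫ kernel s w dw` from `c - i∞` to `c + i∞`. -/
def contourIntegral (s : ℂ) (c : ℝ) : ℂ := ∫ v : ℝ, kernel s (c + I * v) * I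

/-- `f` is holomorphic in a punctured disc around `a` and has residue `ρ` at `a`. -/
def HasResidueAt (f : ℂ → ℂ) (a ρ : ℂ) : Prop :=
  ∃ R > 0, DifferentiableOn ℂ f (Metric.ball a R \ {a}) ∧
    ∀ r : ℝ, 0 < r → r < R → (∮ w in C(a, r), f w) = 2 * Real.pi * I * ρ

/-- Residue at the fixed pole `w = -3/2`. -/
def resBlue : ℂ := 1 / (2 * Real.pi * I)

/-- Residue at the pole `w = -s/2 - 1`. -/
def resRed (s : ℂ) : ℂ := I * xi s / (2 * Real.pi)

/-- Residue at the pole `w = (s - 3)/2`. -/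
def resGreen (s : ℂ) : ℂ :=
  I * s * (Real.pi : ℂ) ^ ((s - 3) / 2) * riemannZeta (1 - s) *
    Complex.Gamma (-s / 2 + 1 / 2) * (s - 1) / 4

/-! The regions of the `(σ, c)` plane cut out by the lines `c = -3/2`, `c = -σ/2 - 1` and
`c = σ/2 - 3/2` over `0 ≤ σ ≤ 1`, lines excluded. -/

/-- Above the line `c = -3/2`, below the two slanted lines. -/
def regionII : Set (ℝ × ℝ) :=
  {p | 0 ≤ p.1 ∧ p.1 ≤ 1 ∧ -3 / 2 < p.2 ∧ p.2 < -p.1 / 2 - 1 ∧ p.2 < p.1 / 2 - 3 / 2}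

/-- Above `c = -σ/2 - 1`, below `c = σ/2 - 3/2`. -/
def regionIII : Set (ℝ × ℝ) :=
  {p | 0 ≤ p.1 ∧ p.1 ≤ 1 ∧ -3 / 2 < p.2 ∧ -p.1 / 2 - 1 < p.2 ∧ p.2 < p.1 / 2 - 3 / 2}

/-- Above both slanted lines. -/
def regionIV : Set (ℝ × ℝ) :=
  {p | 0 ≤ p.1 ∧ p.1 ≤ 1 ∧ -3 / 2 < p.2 ∧ -p.1 / 2 - 1 < p.2 ∧ p.1 / 2 - 3 / 2 < p.2}

/-- Below `c = -σ/2 - 1`, above `c = σ/2 - 3/2`. -/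
def regionV : Set (ℝ × ℝ) :=
  {p | 0 ≤ p.1 ∧ p.1 ≤ 1 ∧ -3 / 2 < p.2 ∧ p.2 < -p.1 / 2 - 1 ∧ p.1 / 2 - 3 / 2 < p.2}

end XiContour

end

/-! ### Theta constants and Jacobi's duplication identities. -/

namespace XiContour

open HurwitzZeta Real Filter Topology

/-! The substitution `u = -2w - 2` sends the line `Re w = c` to `Re u = b`, `b = -2c - 2`. By
partial fractions (`kernel_eq`) the kernel becomes `(i/π) ξ(u) (2/(u-1) - 1/(u-s) - 1/(u-(1-s)))`.
The poles are thus `u = 1, s, 1-s`, and a region records on which side of each the line lies. The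
contour integral is a combination of the Cauchy integrals `cauchyXi a b` with `a = 1, s, 1-s`
(`contourIntegral_eq`), and `J` is minus it, by `v ↦ -v`.

Since `ξ` is `O(1/(1 + y²))` in vertical strips (`exists_norm_riemannXi_le`), `cauchyXi a b` is
constant in `b` on each side of `Re a` and jumps by `2π ξ(a)` across it (`cauchyXi_sub_cauchyXi`).
The symmetry `ξ(1-u) = ξ(u)` gives `cauchyXi_one_sub`; together they make the pair `s, 1-s`
contribute `±2π ξ(s)` or `0`.

The pole `u = 1` needs an actual value. Mellin inversion of the theta function `θ(t) = Σ exp(-π n²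
t)` at `t = 1`, with the same jump and symmetry, gives `cauchyXi 1 b = (π/2) θ(1)` for `b > 1`. That
`θ(1) = π^{1/4}/Γ(3/4)` is proved through the arithmetic-geometric mean: doubling `t` performs one
AGM step on the squares of `θ` and its alternating version, an elliptic integral is invariant under
such steps and tends to `π/2`, and at `t = 1` it is a lemniscatic integral, hence a Beta value.

The shift formulas then follow by comparing the explicit values of both contour integrals with the
residues. -/

theorem hasSum_theta {t : ℝ} (ht : 0 < t) :
    HasSum (fun n : ℤ => rexp (-π * n ^ 2 * t)) (cosKernel 0 t) := by
  have h := hasSum_int_cosKernel 0 ht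
  rw [← Complex.hasSum_ofReal]
  simpa using h

theorem hasSum_thetaAlt {t : ℝ} (ht : 0 < t) :
    HasSum (fun n : ℤ => (-1 : ℝ) ^ n * rexp (-π * n ^ 2 * t)) (cosKernel ((1 / 2 : ℝ)) t) := by
  have h := hasSum_int_cosKernel (1 / 2) ht
  rw [← Complex.hasSum_ofReal]
  refine h.congr_fun fun n => ?_
  have : Complex.exp (2 * π * Complex.I * (1 / 2 : ℝ) * n) = (-1 : ℂ) ^ n := by
    rw [← Complex.exp_pi_mul_I, ← Complex.exp_int_mul]
    congr 1
    push_cast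
    ring
  rw [this]
  push_cast
  rfl

/-- Substituting `(m, n) = (j + k, j - k)` in a double sum supported on `m + n` even. -/
theorem tsum_prod_int_of_even_support {f : ℤ × ℤ → ℝ}
    (hf : ∀ m n, ¬ Even (m + n) → f (m, n) = 0) :
    ∑' p, f p = ∑' p : ℤ × ℤ, f (p.1 + p.2, p.1 - p.2) := by
  have hinj : Function.Injective (fun p : ℤ × ℤ => (p.1 + p.2, p.1 - p.2)) := by
    rintro ⟨a, b⟩ ⟨c, d⟩ h
    simp only [Prod.mk.injEq] at h ⊢
    omega
  refine (hinj.tsum_eq ?_).symm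
  rintro ⟨m, n⟩ h
  have : Even (m + n) := by
    by_contra h'
    exact h (hf m n h')
  obtain ⟨j, hj⟩ := this
  refine ⟨(j, m - j), ?_⟩
  simp only [Prod.mk.injEq]
  omega

theorem neg_one_zpow_add_add_sub (j k : ℤ) : (-1 : ℝ) ^ (j - k) = (-1) ^ (j + k) := by
  have h : (j + k) = (j - k) + 2 * k := by ring
  rw [h, zpow_add₀ (by norm_num), zpow_mul]
  norm_num

theorem tsum_mul_tsum_int {f g : ℤ → ℝ} {x y : ℝ} (hf : HasSum f x) (hg : HasSum g y) :
    HasSum (fun p : ℤ × ℤ => f p.1 * g p.2) (x * y) :=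
  hf.mul hg (summable_mul_of_summable_norm hf.summable.norm hg.summable.norm)

/-- In the double sum the weight `1 + (-1)^(m+n)` kills odd `m + n`; for the rest put `m = j + k`,
`n = j - k` and use `m² + n² = 2(j² + k²)`. With `theta_mul_thetaAlt` this is an AGM step on the
squares. -/
theorem theta_sq_add_thetaAlt_sq {t : ℝ} (ht : 0 < t) :
    cosKernel 0 t ^ 2 + cosKernel ((1 / 2 : ℝ)) t ^ 2 = 2 * cosKernel 0 (2 * t) ^ 2 := by
  have h1 := tsum_mul_tsum_int (hasSum_theta ht) (hasSum_theta ht)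
  have h2 := tsum_mul_tsum_int (hasSum_thetaAlt ht) (hasSum_thetaAlt ht)
  have h3 := tsum_mul_tsum_int (hasSum_theta (by positivity : 0 < 2 * t))
    (hasSum_theta (by positivity : 0 < 2 * t))
  rw [sq, sq, sq, ← (h1.add h2).tsum_eq, tsum_prod_int_of_even_support, ← h3.tsum_eq,
    ← tsum_mul_left]
  · congr 1
    ext ⟨j, k⟩
    simp only
    have e : ((-1 : ℝ) ^ (j + k)) * (-1) ^ (j - k) = 1 := by
      rw [neg_one_zpow_add_add_sub, ← zpow_add₀ (by norm_num), Even.neg_one_zpow ⟨j + k, rfl⟩]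
    have e2 : rexp (-π * (j + k : ℤ) ^ 2 * t) * rexp (-π * (j - k : ℤ) ^ 2 * t) =
        rexp (-π * j ^ 2 * (2 * t)) * rexp (-π * k ^ 2 * (2 * t)) := by
      rw [← Real.exp_add, ← Real.exp_add]
      congr 1
      push_cast
      ring
    linear_combination (1 + (-1 : ℝ) ^ (j + k) * (-1) ^ (j - k)) * e2 +
      rexp (-π * j ^ 2 * (2 * t)) * rexp (-π * k ^ 2 * (2 * t)) * e
  · intro m n h
    have e : ((-1 : ℝ) ^ m) * (-1) ^ n = -1 := by
      rw [← zpow_add₀ (by norm_num), (Int.not_even_iff_odd.mp h).neg_one_zpow]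
    simp only
    linear_combination rexp (-π * m ^ 2 * t) * rexp (-π * n ^ 2 * t) * e

theorem theta_mul_thetaAlt {t : ℝ} (ht : 0 < t) :
    cosKernel 0 t * cosKernel ((1 / 2 : ℝ)) t = cosKernel ((1 / 2 : ℝ)) (2 * t) ^ 2 := by
  have h1 := tsum_mul_tsum_int (hasSum_theta ht) (hasSum_thetaAlt ht)
  have h2 := tsum_mul_tsum_int (hasSum_thetaAlt ht) (hasSum_theta ht)
  have h3 := tsum_mul_tsum_int (hasSum_thetaAlt (by positivity : 0 < 2 * t))
    (hasSum_thetaAlt (by positivity : 0 < 2 * t))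
  -- The product is symmetrised so that the weight `(-1)^m + (-1)^n` vanishes for odd `m + n`.
  have : cosKernel 0 t * cosKernel ((1 / 2 : ℝ)) t + cosKernel ((1 / 2 : ℝ)) t * cosKernel 0 t
      = 2 * (cosKernel ((1 / 2 : ℝ)) (2 * t) * cosKernel ((1 / 2 : ℝ)) (2 * t)) := by
    rw [← (h1.add h2).tsum_eq, tsum_prod_int_of_even_support, ← h3.tsum_eq, ← tsum_mul_left]
    · congr 1
      ext ⟨j, k⟩
      simp only
      have e : ((-1 : ℝ) ^ j) * (-1) ^ k = (-1) ^ (j + k) := by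
        rw [← zpow_add₀ (by norm_num)]
      have e2 : rexp (-π * (j + k : ℤ) ^ 2 * t) * rexp (-π * (j - k : ℤ) ^ 2 * t) =
          rexp (-π * j ^ 2 * (2 * t)) * rexp (-π * k ^ 2 * (2 * t)) := by
        rw [← Real.exp_add, ← Real.exp_add]
        congr 1
        push_cast
        ring
      rw [neg_one_zpow_add_add_sub]
      linear_combination 2 * (-1 : ℝ) ^ (j + k) * e2 -
        2 * rexp (-π * j ^ 2 * (2 * t)) * rexp (-π * k ^ 2 * (2 * t)) * e
    · intro m n h
      have e : ((-1 : ℝ) ^ m) = -(-1) ^ n := by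
        have e1 : m = (m + n) + -n := by ring
        have e3 : ((-1 : ℝ)) ^ (-n) = (-1) ^ n := by
          simpa using neg_one_zpow_add_add_sub 0 n
        rw [e1, zpow_add₀ (by norm_num), (Int.not_even_iff_odd.mp h).neg_one_zpow, e3]
        ring
      simp only
      linear_combination rexp (-π * m ^ 2 * t) * rexp (-π * n ^ 2 * t) * e
  linarith

theorem tendsto_cosKernel_one (a : UnitAddCircle) : Tendsto (cosKernel a) atTop (𝓝 1) := by
  obtain ⟨p, hp, h⟩ := isBigO_atTop_cosKernel_sub a
  have h2 : Tendsto (fun x : ℝ => rexp (-p * x)) atTop (𝓝 0) := by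
    refine Real.tendsto_exp_atBot.comp ?_
    exact (tendsto_const_mul_atBot_of_neg (by linarith)).mpr tendsto_id
  have := h.trans_tendsto h2
  simpa using this.add_const 1

theorem theta_pos {t : ℝ} (ht : 0 < t) : 0 < cosKernel 0 t := by
  have h := hasSum_theta ht
  rw [← h.tsum_eq]
  exact h.summable.tsum_pos (fun n => (Real.exp_pos _).le) 0 (Real.exp_pos _)

/-- The product identity makes `θ` times this value a square, so it is nonnegative. A zero at `t`
would propagate to every `2^n t`, against the limit `1` at infinity. -/
theorem thetaAlt_pos {t : ℝ} (ht : 0 < t) : 0 < cosKernel ((1 / 2 : ℝ)) t := by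
  have h : ∀ t : ℝ, 0 < t → 0 ≤ cosKernel ((1 / 2 : ℝ)) t := by
    intro t ht
    have := theta_mul_thetaAlt ht
    have h0 := theta_pos ht
    by_contra hneg
    push Not at hneg
    nlinarith [sq_nonneg (cosKernel ((1 / 2 : ℝ)) (2 * t)), mul_neg_of_pos_of_neg h0 hneg]
  refine (h t ht).lt_of_ne' fun h0 => ?_
  have hz : ∀ n : ℕ, cosKernel ((1 / 2 : ℝ)) (2 ^ n * t) = 0 := by
    intro n
    induction n with
    | zero => simpa using h0
    | succ n ih =>
      have := theta_mul_thetaAlt (t := 2 ^ n * t) (by positivity)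
      rw [ih, mul_zero] at this
      rw [pow_succ']
      have h2 := pow_eq_zero_iff (two_ne_zero) |>.mp this.symm
      rw [← h2]
      ring_nf
  have hlim := (tendsto_cosKernel_one ((1 / 2 : ℝ))).comp
    ((tendsto_pow_atTop_atTop_of_one_lt (one_lt_two (α := ℝ))).atTop_mul_const ht)
  have := tendsto_nhds_unique (hlim.congr hz) tendsto_const_nhds
  norm_num at this

theorem theta_one_div {t : ℝ} : cosKernel 0 t = 1 / t ^ (1 / 2 : ℝ) * cosKernel 0 (1 / t) := by
  have := evenKernel_functional_equation 0 t
  rwa [evenKernel_eq_cosKernel_of_zero] at this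

/-- The Jacobi identity at the fixed point of the modular transformation. -/
theorem two_mul_thetaAlt_one_pow_four :
    2 * cosKernel ((1 / 2 : ℝ)) 1 ^ 4 = cosKernel 0 1 ^ 4 := by
  have h1 := theta_sq_add_thetaAlt_sq (t := 1) one_pos
  have h2 := theta_sq_add_thetaAlt_sq (t := 1 / 2) (by norm_num)
  have h3 := theta_mul_thetaAlt (t := 1 / 2) (by norm_num)
  have h4 := theta_one_div (t := 1 / 2)
  norm_num at h1 h2 h3 h4
  rw [← Real.sqrt_eq_rpow] at h4
  have h5 : cosKernel 0 (1 / 2) ^ 2 = 2 * cosKernel 0 2 ^ 2 := by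
    rw [h4, mul_pow, inv_pow, Real.sq_sqrt (by norm_num)]
    norm_num
  -- With `x = θ(1)²` and `y` its alternating analogue, the factors at `t = 1/2` have squares `x +
  -- y` and `x - y`, so squaring the product identity gives `(x + y)(x - y) = y²`.
  have h6 := congrArg (· ^ 2) h3
  simp only [mul_pow] at h6
  rw [show cosKernel ((1 / 2 : ℝ)) (1 / 2) ^ 2 = cosKernel 0 1 ^ 2 - cosKernel ((1 / 2 : ℝ)) 1 ^ 2 by
    linarith, h5, ← h1] at h6
  linarith

end XiContour

/-! ### Elliptic integrals and the arithmetic-geometric mean. -/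

namespace XiContour

open HurwitzZeta Real Filter Topology Set MeasureTheory

/-- The complete elliptic integral `∫₀^∞ dx / √((x² + p) (x² + q))`. -/
noncomputable def ellipticIntegral (p q : ℝ) : ℝ := ∫ x in Ioi (0 : ℝ), 1 / √((x ^ 2 + p) * (x ^ 2 + q))

/-- The quadratic transformation `u = (x - β / x) / 2` of elliptic integrals. -/
theorem integral_quartic_eq_ellipticIntegral {β p : ℝ} (hβ : 0 < β) (hp : -2 * β < p) :
    ∫ x in Ioi (0 : ℝ), 1 / √(x ^ 4 + p * x ^ 2 + β ^ 2) =
      ellipticIntegral β ((p + 2 * β) / 4) := by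
  set g : ℝ → ℝ := fun u => 1 / √((u ^ 2 + β) * (u ^ 2 + (p + 2 * β) / 4)) with hg
  have hder : ∀ x ∈ Ioi (0 : ℝ), HasDerivWithinAt (fun x : ℝ => (x - β / x) / 2)
      ((1 + β / x ^ 2) / 2) (Ioi 0) x := by
    intro x hx
    have hx0 : x ≠ 0 := (mem_Ioi.mp hx).ne'
    have := (((hasDerivAt_id x).sub ((hasDerivAt_inv hx0).const_mul β)).div_const 2)
    refine HasDerivAt.hasDerivWithinAt ?_
    convert! this using 1
    field_simp
    ring
  have hinj : InjOn (fun x : ℝ => (x - β / x) / 2) (Ioi 0) := by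
    intro x hx y hy h
    have hx0 : 0 < x := hx
    have hy0 : 0 < y := hy
    simp only at h
    field_simp at h
    have : (x - y) * (x * y + β) = 0 := by linear_combination h
    rcases mul_eq_zero.mp this with h | h
    · linarith
    · nlinarith [mul_pos hx0 hy0]
  have himg : (fun x : ℝ => (x - β / x) / 2) '' Ioi 0 = univ := by
    refine eq_univ_of_forall fun u => ?_
    have h1 : |u| < √(u ^ 2 + β) := by
      rw [← Real.sqrt_sq_eq_abs]
      exact Real.sqrt_lt_sqrt (sq_nonneg _) (by linarith)
    have hpos : 0 < u + √(u ^ 2 + β) := by linarith [neg_abs_le u]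
    refine ⟨u + √(u ^ 2 + β), hpos, ?_⟩
    have h2 : √(u ^ 2 + β) ^ 2 = u ^ 2 + β := Real.sq_sqrt (by positivity)
    simp only
    field_simp
    linear_combination h2
  have hcv := integral_image_eq_integral_abs_deriv_smul measurableSet_Ioi hder hinj g
  rw [himg, setIntegral_univ] at hcv
  have heven : ∫ u, g u = 2 * ellipticIntegral β ((p + 2 * β) / 4) := by
    rw [ellipticIntegral, ← integral_comp_abs]
    simp [hg]
  have hpt : ∫ x in Ioi (0 : ℝ), |(1 + β / x ^ 2) / 2| • g ((x - β / x) / 2) =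
      2 * ∫ x in Ioi (0 : ℝ), 1 / √(x ^ 4 + p * x ^ 2 + β ^ 2) := by
    rw [← integral_const_mul]
    refine setIntegral_congr_fun measurableSet_Ioi fun x hx => ?_
    have hx0 : 0 < x := hx
    -- The first factor is `((x + β/x)/2)²`, whose root is `x` times the Jacobian; the second is the
    -- quartic over `4x²`.
    have e : (((x - β / x) / 2) ^ 2 + β) * (((x - β / x) / 2) ^ 2 + (p + 2 * β) / 4) =
        ((1 + β / x ^ 2) / 4) ^ 2 * (x ^ 4 + p * x ^ 2 + β ^ 2) := by
      field_simp
      ring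
    have hQ : 0 < x ^ 4 + p * x ^ 2 + β ^ 2 := by nlinarith [sq_nonneg (x ^ 2 - β), pow_pos hx0 2]
    have hd : 0 < 1 + β / x ^ 2 := by positivity
    simp only [hg, smul_eq_mul]
    rw [e, Real.sqrt_mul (by positivity), Real.sqrt_sq (by positivity), abs_of_pos (by positivity)]
    have := (Real.sqrt_pos.mpr hQ).ne'
    field_simp
    ring
  linarith

theorem ellipticIntegral_comm (p q : ℝ) : ellipticIntegral p q = ellipticIntegral q p := by
  simp only [ellipticIntegral, mul_comm]

/-- Gauss's invariance of the elliptic integral under the arithmetic-geometric mean. -/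
theorem ellipticIntegral_agm {a b : ℝ} (ha : 0 < a) (hb : 0 < b) :
    ellipticIntegral (a ^ 2) (b ^ 2) = ellipticIntegral (((a + b) / 2) ^ 2) (a * b) := by
  have h := integral_quartic_eq_ellipticIntegral (mul_pos ha hb) (p := a ^ 2 + b ^ 2)
    (by nlinarith [mul_pos ha hb])
  rw [ellipticIntegral_comm (((a + b) / 2) ^ 2)]
  have e : ((a + b) / 2) ^ 2 = (a ^ 2 + b ^ 2 + 2 * (a * b)) / 4 := by ring
  rw [e, ← h, ellipticIntegral]
  congr 1
  ext x
  congr 2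
  ring

theorem ellipticIntegral_theta {t : ℝ} (ht : 0 < t) :
    ellipticIntegral (cosKernel 0 t ^ 4) (cosKernel ((1 / 2 : ℝ)) t ^ 4) =
      ellipticIntegral (cosKernel 0 (2 * t) ^ 4) (cosKernel ((1 / 2 : ℝ)) (2 * t) ^ 4) := by
  -- The AGM acts on the squares of the theta values, so fourth powers enter the integral.
  have h := ellipticIntegral_agm (pow_pos (theta_pos ht) 2) (pow_pos (thetaAlt_pos ht) 2)
  rw [theta_sq_add_thetaAlt_sq ht, ← mul_pow, theta_mul_thetaAlt ht] at h
  convert! h using 2 <;> ring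

theorem tendsto_ellipticIntegral_one {ι : Type*} {l : Filter ι} [l.IsCountablyGenerated]
    {p q : ι → ℝ} (hp : Tendsto p l (𝓝 1)) (hq : Tendsto q l (𝓝 1)) :
    Tendsto (fun i => ellipticIntegral (p i) (q i)) l (𝓝 (π / 2)) := by
  have hlim : ∫ x in Ioi (0 : ℝ), (1 + x ^ 2)⁻¹ = π / 2 := by
    rw [integral_Ioi_inv_one_add_sq, Real.arctan_zero, sub_zero]
  rw [← hlim]
  refine tendsto_integral_filter_of_dominated_convergence (fun x => 2 * (1 + x ^ 2)⁻¹) ?_ ?_ ?_ ?_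
  · refine Eventually.of_forall fun i => Measurable.aestronglyMeasurable ?_
    fun_prop
  · filter_upwards [hp.eventually (lt_mem_nhds (show (1 / 2 : ℝ) < 1 by norm_num)),
      hq.eventually (lt_mem_nhds (show (1 / 2 : ℝ) < 1 by norm_num))] with i h1 h2
    refine Eventually.of_forall fun x => ?_
    have h3 : (1 + x ^ 2) / 2 ≤ √((x ^ 2 + p i) * (x ^ 2 + q i)) := by
      refine Real.le_sqrt_of_sq_le ?_
      rw [sq]
      have := sq_nonneg x
      exact mul_le_mul (by linarith) (by linarith) (by positivity) (by positivity)
    rw [Real.norm_of_nonneg (by positivity)]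
    calc 1 / √((x ^ 2 + p i) * (x ^ 2 + q i)) ≤ 1 / ((1 + x ^ 2) / 2) :=
          one_div_le_one_div_of_le (by positivity) h3
      _ = 2 * (1 + x ^ 2)⁻¹ := by field_simp
  · exact (integrable_inv_one_add_sq.const_mul 2).integrableOn
  · refine Eventually.of_forall fun x => ?_
    have h1 : Tendsto (fun i => √((x ^ 2 + p i) * (x ^ 2 + q i))) l (𝓝 (1 + x ^ 2)) := by
      have := ((hp.const_add (x ^ 2)).mul (hq.const_add (x ^ 2))).sqrt
      rwa [Real.sqrt_mul_self (by positivity), add_comm] at this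
    simpa using h1.inv₀ (by positivity)

theorem ellipticIntegral_theta_one :
    ellipticIntegral (cosKernel 0 1 ^ 4) (cosKernel ((1 / 2 : ℝ)) 1 ^ 4) = π / 2 := by
  have hc : ∀ n : ℕ, ellipticIntegral (cosKernel 0 1 ^ 4) (cosKernel ((1 / 2 : ℝ)) 1 ^ 4) =
      ellipticIntegral (cosKernel 0 (2 ^ n) ^ 4) (cosKernel ((1 / 2 : ℝ)) (2 ^ n) ^ 4) := by
    intro n
    induction n with
    | zero => simp
    | succ n ih => rw [ih, ellipticIntegral_theta (by positivity), pow_succ' (2 : ℝ) n]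
  have h2 := tendsto_pow_atTop_atTop_of_one_lt (one_lt_two (α := ℝ))
  have h := tendsto_ellipticIntegral_one
    (by simpa only [one_pow] using ((tendsto_cosKernel_one 0).comp h2).pow 4)
    (by simpa only [one_pow] using ((tendsto_cosKernel_one ((1 / 2 : ℝ))).comp h2).pow 4)
  exact tendsto_nhds_unique tendsto_const_nhds (h.congr fun n => (hc n).symm)

theorem ellipticIntegral_smul {c p q : ℝ} (hc : 0 < c) :
    ellipticIntegral (c ^ 2 * p) (c ^ 2 * q) = c⁻¹ * ellipticIntegral p q := by
  have h := integral_comp_mul_left_Ioi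
    (fun x : ℝ => 1 / √((x ^ 2 + c ^ 2 * p) * (x ^ 2 + c ^ 2 * q))) 0 hc
  rw [mul_zero, smul_eq_mul, ← ellipticIntegral] at h
  have h2 : ∫ x in Ioi (0 : ℝ), 1 / √(((c * x) ^ 2 + c ^ 2 * p) * ((c * x) ^ 2 + c ^ 2 * q)) =
      (c ^ 2)⁻¹ * ellipticIntegral p q := by
    rw [ellipticIntegral, ← integral_const_mul]
    congr 1
    ext x
    rw [show ((c * x) ^ 2 + c ^ 2 * p) * ((c * x) ^ 2 + c ^ 2 * q) =
      (c ^ 2) ^ 2 * ((x ^ 2 + p) * (x ^ 2 + q)) by ring, Real.sqrt_mul (by positivity),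
      Real.sqrt_sq (by positivity), one_div, one_div, mul_inv]
  rw [h2] at h
  field_simp at h ⊢
  linarith

end XiContour

/-! ### The lemniscatic integral and the value of `θ(1)`. -/

namespace XiContour

open HurwitzZeta Real Filter Topology Set MeasureTheory

theorem integral_rpow_mul_one_sub_rpow {a b : ℝ} (ha : 0 < a) (hb : 0 < b) :
    ∫ t in Ioo (0 : ℝ) 1, t ^ (a - 1) * (1 - t) ^ (b - 1) = ProbabilityTheory.beta a b := by
  rw [ProbabilityTheory.beta_eq_betaIntegralReal a b ha hb, Complex.betaIntegral,
    intervalIntegral.integral_of_le zero_le_one, integral_Ioc_eq_integral_Ioo]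
  have : ∫ x in Ioo (0 : ℝ) 1, (x : ℂ) ^ ((a : ℂ) - 1) * (1 - (x : ℂ)) ^ ((b : ℂ) - 1) =
      ((∫ t in Ioo (0 : ℝ) 1, t ^ (a - 1) * (1 - t) ^ (b - 1) : ℝ) : ℂ) := by
    rw [← integral_complex_ofReal]
    refine setIntegral_congr_fun measurableSet_Ioo fun x hx => ?_
    rw [Complex.ofReal_mul, Complex.ofReal_cpow hx.1.le, Complex.ofReal_cpow (by linarith [hx.2])]
    push_cast
    rfl
  rw [this, Complex.ofReal_re]

theorem integral_one_div_sqrt_one_add_pow_four :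
    ∫ x in Ioi (0 : ℝ), 1 / √(x ^ 4 + 1) = ProbabilityTheory.beta (1 / 4) (1 / 4) / 4 := by
  -- The substitution `t = x⁴/(x⁴ + 1)` carries the half-line to the Beta interval.
  have hder : ∀ x ∈ Ioi (0 : ℝ), HasDerivWithinAt (fun x : ℝ => x ^ 4 / (x ^ 4 + 1))
      (4 * x ^ 3 / (x ^ 4 + 1) ^ 2) (Ioi 0) x := by
    intro x hx
    have h4 : x ^ 4 + 1 ≠ 0 := by positivity
    have := (hasDerivAt_pow 4 x).div ((hasDerivAt_pow 4 x).add_const 1) h4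
    refine HasDerivAt.hasDerivWithinAt ?_
    convert! this using 1
    field_simp
    ring
  have hinj : InjOn (fun x : ℝ => x ^ 4 / (x ^ 4 + 1)) (Ioi 0) := by
    intro x hx y hy h
    have hx0 : 0 < x := hx
    have hy0 : 0 < y := hy
    simp only at h
    field_simp at h
    exact (pow_left_inj₀ hx0.le hy0.le (four_ne_zero)).mp (by linarith)
  have himg : (fun x : ℝ => x ^ 4 / (x ^ 4 + 1)) '' Ioi 0 = Ioo 0 1 := by
    ext t
    constructor
    · rintro ⟨x, hx, rfl⟩
      have hx0 : 0 < x := hx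
      exact ⟨by positivity, (div_lt_one (by positivity)).mpr (by linarith)⟩
    · rintro ⟨h0, h1⟩
      have h1' : 0 < 1 - t := by linarith
      refine ⟨(t / (1 - t)) ^ (1 / 4 : ℝ), Real.rpow_pos_of_pos (by positivity) _, ?_⟩
      have : ((t / (1 - t)) ^ (1 / 4 : ℝ)) ^ 4 = t / (1 - t) := by
        rw [← Real.rpow_natCast, ← Real.rpow_mul (by positivity)]
        norm_num
      simp only [this]
      field_simp
      ring
  have hcv := integral_image_eq_integral_abs_deriv_smul measurableSet_Ioi hder hinj
    (fun t => t ^ ((1 / 4 : ℝ) - 1) * (1 - t) ^ ((1 / 4 : ℝ) - 1))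
  rw [himg, integral_rpow_mul_one_sub_rpow (by norm_num) (by norm_num)] at hcv
  rw [hcv, eq_div_iff (by norm_num), ← integral_mul_const]
  refine setIntegral_congr_fun measurableSet_Ioi fun x hx => ?_
  have hx0 : 0 < x := hx
  have h1 : 1 - x ^ 4 / (x ^ 4 + 1) = 1 / (x ^ 4 + 1) := by field_simp; ring
  simp only [smul_eq_mul]
  rw [h1, abs_of_pos (by positivity), Real.div_rpow (by positivity) (by positivity),
    Real.div_rpow (by positivity) (by positivity), Real.one_rpow, div_mul_div_comm, mul_one,
    ← Real.rpow_add (by positivity), ← Real.rpow_natCast x 4, ← Real.rpow_mul hx0.le,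
    Real.sqrt_eq_rpow]
  set y : ℝ := x ^ ((4 : ℕ) : ℝ) + 1 with hy
  have hy0 : 0 < y := by positivity
  have e1 : x ^ (((4 : ℕ) : ℝ) * (1 / 4 - 1)) = (x ^ 3)⁻¹ := by
    rw [← Real.rpow_natCast, ← Real.rpow_neg hx0.le]
    norm_num
  have e2 : y ^ (1 / 4 - 1 + (1 / 4 - 1) : ℝ) = y ^ (1 / 2 : ℝ) * (y ^ 2)⁻¹ := by
    rw [← Real.rpow_natCast, ← Real.rpow_neg hy0.le, ← Real.rpow_add hy0]
    norm_num
  rw [e1, e2]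
  have := (Real.rpow_pos_of_pos hy0 (1 / 2)).ne'
  field_simp

/-- Scaling `θ(1)²` out of the invariant integral leaves `ellipticIntegral 1 (1/2) = (π/2) θ(1)²`.
The quadratic transformation with `β = 1`, `p = 0` makes the left side lemniscatic, and the
reflection formula trades `Γ(1/4)` for `Γ(3/4)`. -/
theorem theta_one_sq : cosKernel 0 1 ^ 2 = √π / Real.Gamma (3 / 4) ^ 2 := by
  have hθ := theta_pos one_pos
  have h1 := ellipticIntegral_theta_one
  rw [show cosKernel ((1 / 2 : ℝ)) 1 ^ 4 = (cosKernel 0 1 ^ 2) ^ 2 * (1 / 2) by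
      linarith [two_mul_thetaAlt_one_pow_four],
    show cosKernel 0 1 ^ 4 = (cosKernel 0 1 ^ 2) ^ 2 * 1 by ring,
    ellipticIntegral_smul (by positivity)] at h1
  have h2 := integral_quartic_eq_ellipticIntegral (β := 1) (p := 0) one_pos (by norm_num)
  norm_num only [zero_mul, add_zero, one_pow] at h2
  have h3 := integral_one_div_sqrt_one_add_pow_four
  have hG := Real.Gamma_mul_Gamma_one_sub (1 / 4)
  have hpos := Real.Gamma_pos_of_pos (show (0 : ℝ) < 3 / 4 by norm_num)
  rw [show π * (1 / 4) = π / 4 by ring, Real.sin_pi_div_four,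
    show (1 : ℝ) - 1 / 4 = 3 / 4 by norm_num] at hG
  have h4 : ProbabilityTheory.beta (1 / 4) (1 / 4) = Real.Gamma (1 / 4) ^ 2 / √π := by
    rw [ProbabilityTheory.beta, show (1 / 4 : ℝ) + 1 / 4 = 1 / 2 by norm_num,
      Real.Gamma_one_half_eq, sq]
  have h5 : Real.Gamma (1 / 4) = 2 * π / √2 / Real.Gamma (3 / 4) := by
    rw [eq_div_iff hpos.ne', hG]
    field_simp
  have h6 : ellipticIntegral 1 (1 / 2) = Real.Gamma (1 / 4) ^ 2 / √π / 4 := by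
    rw [← h4, ← h3]
    exact h2.symm
  rw [h6, h5, div_pow, div_pow, Real.sq_sqrt (by norm_num)] at h1
  have hs : √π ^ 2 = π := Real.sq_sqrt Real.pi_pos.le
  have hs0 : 0 < √π := Real.sqrt_pos.mpr Real.pi_pos
  have hp := Real.pi_pos
  field_simp at h1 ⊢
  have : √π * (√π - cosKernel 0 1 ^ 2 * Real.Gamma (3 / 4) ^ 2) = 0 := by
    rw [mul_sub, ← sq, hs]
    nlinarith
  have := (mul_eq_zero.mp this).resolve_left hs0.ne'
  linarith

theorem theta_one : cosKernel 0 1 = 2 * A := by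
  have hpos := Real.Gamma_pos_of_pos (show (0 : ℝ) < 3 / 4 by norm_num)
  refine (pow_left_inj₀ (theta_pos one_pos).le ?_ two_ne_zero).mp ?_
  · rw [A]
    positivity
  · have : (π ^ (1 / 4 : ℝ)) ^ 2 = √π := by
      rw [← Real.rpow_natCast, ← Real.rpow_mul Real.pi_pos.le, Real.sqrt_eq_rpow]
      norm_num
    rw [theta_one_sq, A, ← this]
    field_simp

end XiContour

/-! ### The entire function `ξ` and its decay in vertical strips. -/

namespace XiContour

open Complex Filter Topology Set MeasureTheory HurwitzZeta

/-- Riemann's `ξ` as an entire function. -/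
noncomputable def riemannXi (u : ℂ) : ℂ := (u * (u - 1) * completedRiemannZeta₀ u + 1) / 2

theorem differentiable_riemannXi : Differentiable ℂ riemannXi := by
  have := differentiable_completedZeta₀
  unfold riemannXi
  fun_prop

theorem riemannXi_one_sub (u : ℂ) : riemannXi (1 - u) = riemannXi u := by
  rw [riemannXi, riemannXi, completedRiemannZeta₀_one_sub]
  ring

theorem riemannXi_one : riemannXi 1 = 1 / 2 := by simp [riemannXi]

/-- Nonvanishing of `Γ` excludes exactly its poles, where `Complex.Gamma` has the default value `0`.
-/
theorem xiProduct_eq_riemannXi {s : ℂ} (hs : s ≠ 1) (hΓ : Complex.Gamma (1 + s / 2) ≠ 0) :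
    xiProduct s = riemannXi s := by
  have hpi : (Real.pi : ℂ) ^ (-s / 2) ≠ 0 := by
    simp [Complex.cpow_eq_zero_iff, Real.pi_ne_zero]
  rw [xiProduct, riemannXi, riemannZeta_eq_mul_completedRiemannZeta₀, add_comm (s / 2) 1]
  have h1 : 1 - s ≠ 0 := sub_ne_zero.mpr hs.symm
  generalize Complex.Gamma (1 + s / 2) = g at *
  field_simp
  ring

theorem xi_eq_riemannXi {s : ℂ} (hs : 0 ≤ s.re) : xi s = riemannXi s := by
  rw [xi]
  split_ifs with h
  · rw [h, riemannXi_one]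
  · refine xiProduct_eq_riemannXi h (Complex.Gamma_ne_zero_of_re_pos ?_)
    simp
    linarith

theorem riemannXi_eq_mul_completedRiemannZeta {u : ℂ} (h0 : u ≠ 0) (h1 : u ≠ 1) :
    riemannXi u = u * (u - 1) * completedRiemannZeta u / 2 := by
  have h2 : 1 - u ≠ 0 := sub_ne_zero.mpr h1.symm
  rw [completedRiemannZeta_eq, riemannXi]
  field_simp
  ring

theorem norm_Gamma_le {z : ℂ} (hz : 0 < z.re) : ‖Complex.Gamma z‖ ≤ Real.Gamma z.re := by
  rw [Complex.Gamma_eq_integral hz, Real.Gamma_eq_integral hz, Complex.GammaIntegral]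
  refine (norm_integral_le_integral_norm _).trans_eq ?_
  refine setIntegral_congr_fun measurableSet_Ioi fun x hx => ?_
  have hx0 : 0 < x := hx
  simp only [norm_mul, Complex.norm_real, Complex.norm_cpow_eq_rpow_re_of_pos hx0]
  rw [Real.norm_of_nonneg (Real.exp_pos _).le]
  simp

/-- Three steps of the recursion lead to `Γ(z + 3)`. Of the three powers gained, one absorbs the
factor `u - 1` of `ξ` and two give the decay `1/(1 + y²)`. -/
theorem norm_Gamma_mul_norm_pow_three_le {z : ℂ} (hz : 0 < z.re) :
    ‖Complex.Gamma z‖ * ‖z‖ ^ 3 ≤ Real.Gamma (z.re + 3) := by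
  have hne : ∀ x : ℝ, 0 ≤ x → z + x ≠ 0 := fun x hx h => by
    have := congrArg Complex.re h
    simp at this
    linarith
  have h1 : Complex.Gamma (z + 3) = (z + 2) * ((z + 1) * (z * Complex.Gamma z)) := by
    have h0 := hne 0 le_rfl
    have h1 := hne 1 zero_le_one
    have h2 := hne 2 zero_le_two
    push_cast at h0 h1 h2
    rw [add_zero] at h0
    rw [← Complex.Gamma_add_one z h0, ← Complex.Gamma_add_one _ h1, add_assoc z 1 1,
      show (1 : ℂ) + 1 = 2 by norm_num, ← Complex.Gamma_add_one _ h2]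
    congr 1
    ring
  have hle : ∀ x : ℝ, 0 ≤ x → ‖z‖ ≤ ‖z + x‖ := fun x hx => by
    rw [Complex.norm_def, Complex.norm_def]
    refine Real.sqrt_le_sqrt ?_
    simp only [Complex.normSq_apply, Complex.add_re, Complex.add_im, Complex.ofReal_re,
      Complex.ofReal_im, add_zero]
    nlinarith
  have h2 := norm_Gamma_le (z := z + 3) (by simp; linarith)
  rw [h1, norm_mul, norm_mul, norm_mul] at h2
  have e1 := hle 1 zero_le_one
  have e2 := hle 2 zero_le_two
  push_cast at e1 e2
  have e3 : (z + 3).re = z.re + 3 := by simp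
  rw [e3] at h2
  refine le_trans ?_ h2
  calc ‖Complex.Gamma z‖ * ‖z‖ ^ 3 = ‖z‖ * (‖z‖ * (‖z‖ * ‖Complex.Gamma z‖)) := by ring
    _ ≤ _ := by gcongr

theorem norm_riemannZeta_le {u : ℂ} (hu : 1 < u.re) :
    ‖riemannZeta u‖ ≤ ∑' n : ℕ, 1 / (n : ℝ) ^ u.re := by
  have hs : Summable fun n : ℕ => 1 / (n : ℝ) ^ u.re := Real.summable_one_div_nat_rpow.mpr hu
  have he : ∀ n : ℕ, ‖1 / (n : ℂ) ^ u‖ = 1 / (n : ℝ) ^ u.re := by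
    intro n
    rcases n.eq_zero_or_pos with rfl | hn
    · have h0 : u ≠ 0 := fun h => by simp [h] at hu; linarith
      have h1 : u.re ≠ 0 := by linarith
      simp [h0, h1]
    · rw [norm_div, norm_one, Complex.norm_natCast_cpow_of_pos hn]
  rw [zeta_eq_tsum_one_div_nat_cpow hu]
  exact tsum_of_norm_bounded hs.hasSum fun n => (he n).le

theorem exists_norm_riemannXi_le_of_re_eq {B : ℝ} (hB : 1 < B) :
    ∃ C, 0 ≤ C ∧ ∀ u : ℂ, u.re = B → ‖riemannXi u‖ ≤ C / (1 + u.im ^ 2) := by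
  refine ⟨20 * (∑' n : ℕ, 1 / (n : ℝ) ^ B) * Real.Gamma (1 + B / 2 + 3), ?_, fun u hu => ?_⟩
  · have := Real.Gamma_pos_of_pos (show 0 < 1 + B / 2 + 3 by linarith)
    have h2 : 0 ≤ ∑' n : ℕ, 1 / (n : ℝ) ^ B := tsum_nonneg fun n => by positivity
    positivity
  have hre : (1 + u / 2).re = 1 + B / 2 := by simp [hu]
  have him : (1 + u / 2).im = u.im / 2 := by simp
  have hne : u ≠ 1 := fun h => by simp [h] at hu; linarith
  rw [← xiProduct_eq_riemannXi hne (Complex.Gamma_ne_zero_of_re_pos (by linarith)), xiProduct,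
    norm_mul, norm_mul, norm_mul]
  have hζ := norm_riemannZeta_le (u := u) (by linarith)
  have hΓ := norm_Gamma_mul_norm_pow_three_le (z := 1 + u / 2) (by linarith)
  rw [hre] at hΓ
  rw [hu] at hζ
  have hpi : ‖(Real.pi : ℂ) ^ (-u / 2)‖ ≤ 1 := by
    rw [Complex.norm_cpow_eq_rpow_re_of_pos Real.pi_pos]
    refine Real.rpow_le_one_of_one_le_of_nonpos (by linarith [Real.pi_gt_three]) ?_
    simp
    linarith
  have hz1 : 1 ≤ ‖1 + u / 2‖ := by
    have := Complex.re_le_norm (1 + u / 2)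
    linarith
  have hu1 : ‖u - 1‖ ≤ 5 * ‖1 + u / 2‖ := by
    calc ‖u - 1‖ = ‖2 * (1 + u / 2) - 3‖ := by congr 1; ring
      _ ≤ ‖2 * (1 + u / 2)‖ + ‖(3 : ℂ)‖ := norm_sub_le _ _
      _ ≤ _ := by
        rw [norm_mul]
        norm_num
        linarith
  have hz2 : (1 + u.im ^ 2) ≤ 4 * ‖1 + u / 2‖ ^ 2 := by
    rw [← Complex.normSq_eq_norm_sq, Complex.normSq_apply, hre, him]
    nlinarith
  rw [le_div_iff₀ (by positivity)]
  set Z := ∑' n : ℕ, 1 / (n : ℝ) ^ B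
  set n := ‖1 + u / 2‖
  calc ‖u - 1‖ * ‖(Real.pi : ℂ) ^ (-u / 2)‖ * ‖riemannZeta u‖ * ‖Complex.Gamma (1 + u / 2)‖ *
        (1 + u.im ^ 2)
      ≤ (5 * n) * 1 * Z * ‖Complex.Gamma (1 + u / 2)‖ * (4 * n ^ 2) := by
        gcongr
    _ = 20 * Z * (‖Complex.Gamma (1 + u / 2)‖ * n ^ 3) := by ring
    _ ≤ _ := by
        have : 0 ≤ Z := (norm_nonneg _).trans hζ
        gcongr

/-- For `a ≤ σ ≤ b` one has `t^(σ-1) ≤ t^(a-1) + t^(b-1)`. -/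
theorem exists_norm_mellin_le {f : ℝ → ℂ} {a b : ℝ} (ha : MellinConvergent f a)
    (hb : MellinConvergent f b) :
    ∃ C, ∀ s : ℂ, a ≤ s.re → s.re ≤ b → ‖mellin f s‖ ≤ C := by
  refine ⟨∫ t in Ioi (0 : ℝ), (‖(t : ℂ) ^ ((a : ℂ) - 1) • f t‖ + ‖(t : ℂ) ^ ((b : ℂ) - 1) • f t‖),
    fun s h1 h2 => ?_⟩
  refine norm_integral_le_of_norm_le (ha.norm.add hb.norm) ?_
  refine (ae_restrict_iff' measurableSet_Ioi).mpr (Eventually.of_forall fun t ht => ?_)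
  have ht0 : 0 < t := ht
  simp only [norm_smul, Complex.norm_cpow_eq_rpow_re_of_pos ht0, Complex.sub_re, Complex.one_re,
    Complex.ofReal_re, ← add_mul]
  refine mul_le_mul_of_nonneg_right ?_ (norm_nonneg _)
  rcases le_total t 1 with h | h
  · have := Real.rpow_le_rpow_of_exponent_ge ht0 h (show a - 1 ≤ s.re - 1 by linarith)
    have := Real.rpow_pos_of_pos ht0 (b - 1)
    linarith
  · have := Real.rpow_le_rpow_of_exponent_le h (show s.re - 1 ≤ b - 1 by linarith)
    have := Real.rpow_pos_of_pos ht0 (a - 1)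
    linarith

theorem exists_norm_completedRiemannZeta₀_le (a b : ℝ) :
    ∃ C, ∀ u : ℂ, a ≤ u.re → u.re ≤ b → ‖completedRiemannZeta₀ u‖ ≤ C := by
  have hc : ∀ s, MellinConvergent (hurwitzEvenFEPair 0).f_modif s := fun s =>
    ((hurwitzEvenFEPair 0).isStrongFEPair_toStrongFEPair.hasMellin s).1
  obtain ⟨C, hC⟩ := exists_norm_mellin_le (hc (a / 2 : ℝ)) (hc (b / 2 : ℝ))
  refine ⟨C / 2, fun u h1 h2 => ?_⟩
  have e : (u / 2).re = u.re / 2 := by simp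
  have := hC (u / 2) (by rw [e]; linarith) (by rw [e]; linarith)
  rw [completedRiemannZeta₀, completedHurwitzZetaEven₀, WeakFEPair.Λ₀, norm_div]
  norm_num
  linarith

/-- `ξ` decays in vertical strips. -/
theorem exists_norm_riemannXi_le (a b : ℝ) :
    ∃ C, 0 ≤ C ∧ ∀ u : ℂ, a ≤ u.re → u.re ≤ b → ‖riemannXi u‖ ≤ C / (1 + u.im ^ 2) := by
  -- The strip `1 - B ≤ Re u ≤ B` contains the given one and is stable under `u ↦ 1 - u`; the zeta
  -- series converges absolutely on its right edge.
  set B : ℝ := 2 + |a| + |b| with hBdef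
  have hB : 2 ≤ B := by linarith [abs_nonneg a, abs_nonneg b]
  obtain ⟨C₁, hC₁, h₁⟩ := exists_norm_riemannXi_le_of_re_eq (B := B) (by linarith)
  obtain ⟨C₂, h₂⟩ := exists_norm_completedRiemannZeta₀_le (1 - B) B
  -- Phragmén–Lindelöf is applied to `g`. In the strip `Re (u + B) ≥ 1`, so `|u + B|²` is comparable
  -- to `1 + y²`.
  set g : ℂ → ℂ := fun u => riemannXi u * (u + B) ^ 2 with hg
  have hdiff : Differentiable ℂ g := by
    have := differentiable_riemannXi
    fun_prop
  have hsq : ∀ u : ℂ, 1 - B ≤ u.re → u.re ≤ B →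
      1 + u.im ^ 2 ≤ ‖u + B‖ ^ 2 ∧ ‖u + B‖ ^ 2 ≤ 4 * B ^ 2 * (1 + u.im ^ 2) := by
    intro u h1 h2
    have e : ‖u + B‖ ^ 2 = (u.re + B) ^ 2 + u.im ^ 2 := by
      rw [← Complex.normSq_eq_norm_sq, Complex.normSq_apply]
      simp
      ring
    rw [e]
    constructor
    · nlinarith
    · nlinarith [mul_nonneg (show 0 ≤ 4 * B ^ 2 - 1 by nlinarith) (sq_nonneg u.im)]
  have hline : ∀ u : ℂ, u.re = 1 - B ∨ u.re = B → ‖g u‖ ≤ 4 * B ^ 2 * C₁ := by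
    intro u hu
    have hξ : ‖riemannXi u‖ ≤ C₁ / (1 + u.im ^ 2) := by
      rcases hu with hu | hu
      · have := h₁ (1 - u) (by simp [hu])
        rw [riemannXi_one_sub] at this
        simpa using this
      · exact h₁ u hu
    have h2 := (hsq u (by rcases hu with h | h <;> linarith)
      (by rcases hu with h | h <;> linarith)).2
    have hp : 0 < 1 + u.im ^ 2 := by positivity
    calc ‖g u‖ = ‖riemannXi u‖ * ‖u + B‖ ^ 2 := by rw [hg]; simp
      _ ≤ C₁ / (1 + u.im ^ 2) * (4 * B ^ 2 * (1 + u.im ^ 2)) := by gcongr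
      _ = 4 * B ^ 2 * C₁ := by field_simp
  have hgrowth : ∀ u : ℂ, 1 - B ≤ u.re → u.re ≤ B →
      ‖g u‖ ≤ (4 * B ^ 2 * (4 * B ^ 2 * |C₂| + 1)) * Real.exp (4 * |u.im|) := by
    intro u h1 h2
    have hs := (hsq u h1 h2).2
    have hE : (1 + u.im ^ 2) ^ 2 ≤ Real.exp (4 * |u.im|) := by
      have h3 : 1 + u.im ^ 2 ≤ Real.exp |u.im| ^ 2 := by
        have := Real.add_one_le_exp |u.im|
        nlinarith [abs_nonneg u.im, sq_abs u.im]
      calc (1 + u.im ^ 2) ^ 2 ≤ (Real.exp |u.im| ^ 2) ^ 2 := by gcongr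
        _ = _ := by rw [← pow_mul, ← Real.exp_nat_mul]; norm_num
    have hu : ‖u‖ ≤ ‖u + B‖ + B := by
      calc ‖u‖ = ‖(u + B) - B‖ := by congr 1; ring
        _ ≤ ‖u + B‖ + ‖(B : ℂ)‖ := norm_sub_le _ _
        _ = _ := by rw [Complex.norm_real, Real.norm_of_nonneg (by linarith)]
    have hn : ‖u * (u - 1)‖ ≤ 8 * B ^ 2 * (1 + u.im ^ 2) := by
      have e : ‖u * (u - 1)‖ ^ 2 = (u.re ^ 2 + u.im ^ 2) * ((u.re - 1) ^ 2 + u.im ^ 2) := by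
        rw [norm_mul, mul_pow, ← Complex.normSq_eq_norm_sq, ← Complex.normSq_eq_norm_sq,
          Complex.normSq_apply, Complex.normSq_apply]
        simp
        ring
      have f1 : u.re ^ 2 + u.im ^ 2 ≤ B ^ 2 * (1 + u.im ^ 2) := by
        nlinarith [mul_nonneg (show 0 ≤ B ^ 2 - 1 by nlinarith) (sq_nonneg u.im)]
      have f2 : (u.re - 1) ^ 2 + u.im ^ 2 ≤ B ^ 2 * (1 + u.im ^ 2) := by
        nlinarith [mul_nonneg (show 0 ≤ B ^ 2 - 1 by nlinarith) (sq_nonneg u.im)]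
      have f3 : ‖u * (u - 1)‖ ^ 2 ≤ (B ^ 2 * (1 + u.im ^ 2)) ^ 2 := by
        rw [e, sq (B ^ 2 * _)]
        gcongr
      have := (pow_le_pow_iff_left₀ (norm_nonneg _) (by positivity) two_ne_zero).mp f3
      nlinarith [show 0 ≤ B ^ 2 * (1 + u.im ^ 2) by positivity]
    have hξ : ‖riemannXi u‖ ≤ (4 * B ^ 2 * |C₂| + 1) * (1 + u.im ^ 2) := by
      have h3 : ‖completedRiemannZeta₀ u‖ ≤ |C₂| := (h₂ u h1 h2).trans (le_abs_self _)
      have h4 : ‖u * (u - 1) * completedRiemannZeta₀ u + 1‖ ≤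
          8 * B ^ 2 * (1 + u.im ^ 2) * |C₂| + 1 := by
        refine (norm_add_le _ _).trans ?_
        rw [norm_mul, norm_one]
        gcongr
      rw [riemannXi, norm_div]
      norm_num
      nlinarith [sq_nonneg u.im]
    calc ‖g u‖ = ‖riemannXi u‖ * ‖u + B‖ ^ 2 := by rw [hg]; simp
      _ ≤ ((4 * B ^ 2 * |C₂| + 1) * (1 + u.im ^ 2)) * (4 * B ^ 2 * (1 + u.im ^ 2)) := by gcongr
      _ = (4 * B ^ 2 * (4 * B ^ 2 * |C₂| + 1)) * (1 + u.im ^ 2) ^ 2 := by ring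
      _ ≤ _ := by gcongr
  have hPL : ∀ u : ℂ, 1 - B ≤ u.re → u.re ≤ B → ‖g u‖ ≤ 4 * B ^ 2 * C₁ := by
    intro u h1 h2
    have hw : 0 < B - (1 - B) := by linarith
    -- Half the critical exponent; `4/c` works because `4|y| ≤ (4/c) exp(c|y|)`.
    set c : ℝ := Real.pi / (B - (1 - B)) / 2 with hc
    have hc0 : 0 < c := by have := Real.pi_pos; positivity
    refine PhragmenLindelof.vertical_strip hdiff.diffContOnCl ⟨c, ?_, 4 / c, ?_⟩
      (fun z hz => hline z (Or.inl hz)) (fun z hz => hline z (Or.inr hz)) h1 h2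
    · rw [hc]
      exact half_lt_self (by have := Real.pi_pos; positivity)
    · refine Asymptotics.IsBigO.of_bound (4 * B ^ 2 * (4 * B ^ 2 * |C₂| + 1)) ?_
      refine Filter.mem_inf_of_right ?_
      intro z hz
      have hz' : 1 - B < z.re ∧ z.re < B := hz
      refine (hgrowth z hz'.1.le hz'.2.le).trans ?_
      rw [Real.norm_of_nonneg (Real.exp_pos _).le]
      refine mul_le_mul_of_nonneg_left (Real.exp_le_exp.mpr ?_) (by positivity)
      have h3 := Real.add_one_le_exp (c * |z.im|)
      calc 4 * |z.im| = 4 / c * (c * |z.im|) := by field_simp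
        _ ≤ 4 / c * Real.exp (c * |z.im|) := by gcongr; linarith
  refine ⟨4 * B ^ 2 * C₁, by positivity, fun u h1 h2 => ?_⟩
  have h1' : 1 - B ≤ u.re := by linarith [neg_abs_le a, abs_nonneg b]
  have h2' : u.re ≤ B := by linarith [le_abs_self b, abs_nonneg a]
  have h3 := hPL u h1' h2'
  have h4 := (hsq u h1' h2').1
  rw [le_div_iff₀ (by positivity)]
  calc ‖riemannXi u‖ * (1 + u.im ^ 2) ≤ ‖riemannXi u‖ * ‖u + B‖ ^ 2 := by gcongr
    _ = ‖g u‖ := by rw [hg]; simp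
    _ ≤ _ := h3

end XiContour

/-! ### Cauchy integrals of `ξ` over vertical lines. -/

namespace XiContour

open Complex Filter Topology Set MeasureTheory HurwitzZeta

/-- A function holomorphic and decaying in a vertical strip has equal integrals over its sides. -/
theorem integral_vertical_sub_eq_zero {h : ℂ → ℂ} {b₁ b₂ M y₀ : ℝ} (hb : b₁ ≤ b₂)
    (hd : DifferentiableOn ℂ h (re ⁻¹' Icc b₁ b₂))
    (hM : ∀ x ∈ Icc b₁ b₂, ∀ y ≠ y₀, ‖h (x + (y : ℝ) * I)‖ ≤ M / |y - y₀|)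
    (hi : Integrable fun y : ℝ => h (b₂ + y * I) - h (b₁ + y * I)) :
    ∫ y : ℝ, (h (b₂ + y * I) - h (b₁ + y * I)) = 0 := by
  have hcont : ∀ x ∈ Icc b₁ b₂, Continuous fun y : ℝ => h (x + y * I) := by
    intro x hx
    refine hd.continuousOn.comp_continuous (by fun_prop) fun y => ?_
    simpa using hx
  have hrect : ∀ T : ℝ, 0 ≤ T → ∫ y in -T..T, (h (b₂ + y * I) - h (b₁ + y * I)) =
      I * ((∫ x in b₁..b₂, h (x + (-T : ℝ) * I)) - ∫ x in b₁..b₂, h (x + T * I)) := by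
    intro T hT
    have h1 := integral_boundary_rect_eq_zero_of_differentiableOn h (⟨b₁, -T⟩ : ℂ) ⟨b₂, T⟩
      (hd.mono fun z hz => by
        have := hz.1
        simpa [uIcc_of_le hb] using this)
    simp only [smul_eq_mul] at h1
    rw [intervalIntegral.integral_sub
      ((hcont b₂ (right_mem_Icc.mpr hb)).intervalIntegrable _ _)
      ((hcont b₁ (left_mem_Icc.mpr hb)).intervalIntegrable _ _)]
    linear_combination (-I) * h1 + ((∫ y in -T..T, h (b₂ + y * I)) - ∫ y in -T..T, h (b₁ + y * I))
      * I_mul_I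
  have hlim := intervalIntegral_tendsto_integral hi tendsto_neg_atTop_atBot tendsto_id
  refine tendsto_nhds_unique hlim ?_
  have hbound : ∀ y ≠ y₀, ‖∫ x in b₁..b₂, h (x + (y : ℝ) * I)‖ ≤ M / |y - y₀| * (b₂ - b₁) := by
    intro y hy
    have := intervalIntegral.norm_integral_le_of_norm_le_const (a := b₁) (b := b₂)
      (f := fun x : ℝ => h (x + y * I)) (C := M / |y - y₀|) fun x hx => by
        rw [uIoc_of_le hb] at hx
        exact hM x ⟨hx.1.le, hx.2⟩ y hy
    rwa [abs_of_nonneg (sub_nonneg.mpr hb)] at this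
  have hz1 : Tendsto (fun T : ℝ => ∫ x in b₁..b₂, h (x + T * I)) atTop (𝓝 0) := by
    refine squeeze_zero_norm' ((eventually_ne_atTop y₀).mono hbound) ?_
    have : Tendsto (fun T : ℝ => |T - y₀|) atTop atTop :=
      tendsto_abs_atTop_atTop.comp (tendsto_atTop_add_const_right _ _ tendsto_id)
    simpa using (this.const_div_atTop M).mul_const (b₂ - b₁)
  have hz2 : Tendsto (fun T : ℝ => ∫ x in b₁..b₂, h (x + (-T : ℝ) * I)) atTop (𝓝 0) := by
    refine squeeze_zero_norm'
      ((eventually_ne_atTop (-y₀)).mono fun T hT => hbound (-T) fun h => hT (by linarith)) ?_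
    have : Tendsto (fun T : ℝ => |-T - y₀|) atTop atTop :=
      tendsto_abs_atBot_atTop.comp (tendsto_atBot_add_const_right _ _ tendsto_neg_atTop_atBot)
    simpa using (this.const_div_atTop M).mul_const (b₂ - b₁)
  have := (hz2.sub hz1).const_mul I
  rw [sub_zero, mul_zero] at this
  refine this.congr' ?_
  filter_upwards [eventually_ge_atTop 0] with T hT
  exact (hrect T hT).symm

/-- The Cauchy integral `-i ∫ ξ(u) / (u - a) du` over the line `Re u = b`. -/
noncomputable def cauchyXi (a : ℂ) (b : ℝ) : ℂ := ∫ y : ℝ, riemannXi (b + y * I) / (b + y * I - a)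

theorem line_sub_ne_zero {a : ℂ} {b : ℝ} (hb : b ≠ a.re) (y : ℝ) : (b : ℂ) + y * I - a ≠ 0 :=
  fun h => hb (by simpa [sub_eq_zero] using congrArg re h)

theorem integrable_cauchyXi {a : ℂ} {b : ℝ} (hb : b ≠ a.re) :
    Integrable fun y : ℝ => riemannXi (b + y * I) / (b + y * I - a) := by
  obtain ⟨C, hC0, hC⟩ := exists_norm_riemannXi_le b b
  have hcont : Continuous fun y : ℝ => riemannXi (b + y * I) / (b + y * I - a) :=
    (differentiable_riemannXi.continuous.comp (by fun_prop)).div (by fun_prop) (line_sub_ne_zero hb)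
  refine Integrable.mono' (integrable_inv_one_add_sq.const_mul (C / |b - a.re|))
    hcont.aestronglyMeasurable (Eventually.of_forall fun y => ?_)
  have h1 := hC (b + y * I) (by simp) (by simp)
  have h2 : |b - a.re| ≤ ‖(b : ℂ) + y * I - a‖ := by
    simpa using abs_re_le_norm ((b : ℂ) + y * I - a)
  have h3 : 0 < |b - a.re| := abs_pos.mpr (sub_ne_zero.mpr hb)
  have h4 : ((b : ℂ) + y * I).im = y := by simp
  rw [h4] at h1
  rw [norm_div]
  calc _ ≤ (C / (1 + y ^ 2)) / |b - a.re| := by gcongr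
    _ = _ := by field_simp

theorem abs_sub_im_le_norm (a : ℂ) (x y : ℝ) : |y - a.im| ≤ ‖(x : ℂ) + y * I - a‖ := by
  simpa using abs_im_le_norm ((x : ℂ) + y * I - a)

theorem cauchyXi_eq_of_le {a : ℂ} {b₁ b₂ : ℝ} (hb : b₁ ≤ b₂) (ha : a.re < b₁ ∨ b₂ < a.re) :
    cauchyXi a b₂ = cauchyXi a b₁ := by
  have hne : ∀ b ∈ Icc b₁ b₂, b ≠ a.re := fun b hb' => by
    rcases ha with h | h
    · exact (h.trans_le hb'.1).ne'
    · exact (hb'.2.trans_lt h).ne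
  obtain ⟨C, hC0, hC⟩ := exists_norm_riemannXi_le b₁ b₂
  have h1 := integrable_cauchyXi (hne b₁ (left_mem_Icc.mpr hb))
  have h2 := integrable_cauchyXi (hne b₂ (right_mem_Icc.mpr hb))
  rw [← sub_eq_zero, cauchyXi, cauchyXi, ← integral_sub h2 h1]
  refine integral_vertical_sub_eq_zero (h := fun u => riemannXi u / (u - a)) (M := C) (y₀ := a.im)
    hb ?_ ?_ (h2.sub h1)
  · refine differentiable_riemannXi.differentiableOn.div (by fun_prop) fun u hu h => ?_
    rw [sub_eq_zero] at h
    exact hne u.re hu (by rw [h])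
  · intro x hx y hy
    have h3 := hC (x + y * I) (by simpa using hx.1) (by simpa using hx.2)
    have h5 : C / (1 + ((x : ℂ) + y * I).im ^ 2) ≤ C := div_le_self hC0 (by simp [sq_nonneg])
    rw [norm_div]
    exact div_le_div₀ hC0 (h3.trans h5) (abs_pos.mpr (sub_ne_zero.mpr hy))
      (abs_sub_im_le_norm a x y)

theorem cauchyXi_eq_of_same_side {a : ℂ} {b₁ b₂ : ℝ}
    (h : a.re < b₁ ∧ a.re < b₂ ∨ b₁ < a.re ∧ b₂ < a.re) : cauchyXi a b₁ = cauchyXi a b₂ := by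
  rcases le_total b₁ b₂ with hb | hb
  · exact (cauchyXi_eq_of_le hb (h.imp (·.1) (·.2))).symm
  · exact cauchyXi_eq_of_le hb (h.imp (·.2) (·.1))

theorem cauchyXi_add_one_sub_cauchyXi_sub_one (a : ℂ) :
    cauchyXi a (a.re + 1) - cauchyXi a (a.re - 1) = 2 * Real.pi * riemannXi a := by
  have hp : (a.re + 1 : ℝ) ≠ a.re := by simp
  have hm : (a.re - 1 : ℝ) ≠ a.re := by simp
  have h2 := integrable_cauchyXi hp
  have h1 := integrable_cauchyXi hm
  -- Removing the pole leaves a function decaying only like `1/|y|` on each line; the difference of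
  -- the two lines is integrable, the subtracted part being `ξ(a)` times `2/(1 + t²)`, of integral
  -- `2π`.
  set h : ℂ → ℂ := dslope riemannXi a with hh
  have hval : ∀ u, u - a ≠ 0 → h u = riemannXi u / (u - a) - riemannXi a / (u - a) := by
    intro u hu
    rw [hh, dslope_of_ne _ (sub_ne_zero.mp hu), slope_def_field, sub_div]
  have hK : Integrable fun y : ℝ => riemannXi a * (2 * (((1 + (y - a.im) ^ 2)⁻¹ : ℝ) : ℂ)) :=
    (((integrable_inv_one_add_sq.comp_sub_right a.im).ofReal).const_mul 2).const_mul _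
  have hpt : ∀ y : ℝ, riemannXi ((a.re + 1 : ℝ) + y * I) / ((a.re + 1 : ℝ) + y * I - a) -
      riemannXi ((a.re - 1 : ℝ) + y * I) / ((a.re - 1 : ℝ) + y * I - a) -
      riemannXi a * (2 * (((1 + (y - a.im) ^ 2)⁻¹ : ℝ) : ℂ)) =
      h ((a.re + 1 : ℝ) + y * I) - h ((a.re - 1 : ℝ) + y * I) := by
    intro y
    rw [hval _ (line_sub_ne_zero hp y), hval _ (line_sub_ne_zero hm y)]
    have e1 : ((a.re + 1 : ℝ) : ℂ) + y * I - a = 1 + (y - a.im : ℝ) * I := by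
      apply Complex.ext <;> simp
    have e2 : ((a.re - 1 : ℝ) : ℂ) + y * I - a = -(1 - (y - a.im : ℝ) * I) := by
      apply Complex.ext <;> simp
    have n1 := line_sub_ne_zero hp y
    have n2 := line_sub_ne_zero hm y
    rw [e1] at n1
    rw [e2, neg_ne_zero] at n2
    rw [e1, e2]
    have e3 : (((1 + (y - a.im) ^ 2)⁻¹ : ℝ) : ℂ) =
        ((1 + (y - a.im : ℝ) * I) * (1 - (y - a.im : ℝ) * I))⁻¹ := by
      rw [ofReal_inv]
      congr 1
      push_cast
      linear_combination ((y - a.im : ℂ) ^ 2) * I_sq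
    rw [e3]
    generalize ((y - a.im : ℝ) : ℂ) = t at *
    generalize riemannXi ((a.re + 1 : ℝ) + y * I) = p
    generalize riemannXi ((a.re - 1 : ℝ) + y * I) = q
    generalize riemannXi a = r
    field_simp
    ring
  obtain ⟨C, hC0, hC⟩ := exists_norm_riemannXi_le (a.re - 1) (a.re + 1)
  have hzero := integral_vertical_sub_eq_zero (h := h) (b₁ := a.re - 1) (b₂ := a.re + 1)
    (M := C + ‖riemannXi a‖) (y₀ := a.im) (by linarith) ?_ ?_ ?_
  · simp only [← hpt] at hzero
    have hsub := integral_sub (h2.sub h1) hK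
    simp only [Pi.sub_apply] at hsub
    rw [hsub, integral_sub h2 h1, ← cauchyXi, ← cauchyXi, sub_eq_zero] at hzero
    rw [hzero, integral_const_mul, integral_const_mul, integral_complex_ofReal,
      integral_sub_right_eq_self (fun y : ℝ => (1 + y ^ 2)⁻¹), integral_univ_inv_one_add_sq]
    ring
  · exact ((differentiableOn_dslope univ_mem).mpr differentiable_riemannXi.differentiableOn).mono
      (subset_univ _)
  · intro x hx y hy
    have h3 := hC (x + y * I) (by simpa using hx.1) (by simpa using hx.2)
    have h5 : C / (1 + ((x : ℂ) + y * I).im ^ 2) ≤ C := div_le_self hC0 (by simp [sq_nonneg])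
    have h4 : 0 < |y - a.im| := abs_pos.mpr (sub_ne_zero.mpr hy)
    have h6 := abs_sub_im_le_norm a x y
    rw [hval _ (norm_pos_iff.mp (h4.trans_le h6)), ← sub_div, norm_div]
    exact div_le_div₀ (by positivity)
      ((norm_sub_le _ _).trans (add_le_add_left (h3.trans h5) _)) h4 h6
  · simp only [← hpt]
    exact (h2.sub h1).sub hK

theorem cauchyXi_sub_cauchyXi {a : ℂ} {b₁ b₂ : ℝ} (h₁ : b₁ < a.re) (h₂ : a.re < b₂) :
    cauchyXi a b₂ - cauchyXi a b₁ = 2 * Real.pi * riemannXi a := by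
  rw [← cauchyXi_add_one_sub_cauchyXi_sub_one,
    cauchyXi_eq_of_same_side (b₁ := b₂) (b₂ := a.re + 1) (Or.inl ⟨h₂, by linarith⟩),
    cauchyXi_eq_of_same_side (b₁ := b₁) (b₂ := a.re - 1) (Or.inr ⟨h₁, by linarith⟩)]

theorem cauchyXi_one_sub (a : ℂ) (b : ℝ) : cauchyXi (1 - a) (1 - b) = -cauchyXi a b := by
  rw [cauchyXi, cauchyXi, ← integral_neg, ← integral_neg_eq_self]
  congr 1
  ext y
  rw [← riemannXi_one_sub, ← div_neg]
  congr 2 <;> push_cast <;> ring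

theorem hurwitzEvenFEPair_zero_Λ (z : ℂ) :
    (hurwitzEvenFEPair 0).Λ z = 2 * completedRiemannZeta (2 * z) := by
  rw [completedRiemannZeta, completedHurwitzZetaEven, mul_div_cancel_left₀ _ two_ne_zero]
  ring

/-- Mellin inversion for the theta function at the point `1`. -/
theorem integral_completedRiemannZeta {b : ℝ} (hb : 1 < b)
    (hi : Integrable fun y : ℝ => completedRiemannZeta (b + y * I)) :
    ∫ y : ℝ, completedRiemannZeta (b + y * I) = 2 * Real.pi * (cosKernel 0 1 - 1 : ℝ) := by
  set f : ℝ → ℂ := fun x => (hurwitzEvenFEPair 0).f x - (hurwitzEvenFEPair 0).f₀ with hf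
  -- The Mellin variable is half the zeta variable, so `b > 1` places the line to the right of `k =
  -- 1/2`.
  have hM : ∀ y : ℝ, HasMellin f ((b / 2 : ℝ) + y * I)
      (2 * completedRiemannZeta (b + (2 * y : ℝ) * I)) := by
    intro y
    have hk : (hurwitzEvenFEPair 0).k < (((b / 2 : ℝ) : ℂ) + y * I).re := by
      simp only [hurwitzEvenFEPair]
      simp
      linarith
    have := (hurwitzEvenFEPair 0).hasMellin hk
    rw [hurwitzEvenFEPair_zero_Λ] at this
    convert! this using 3
    push_cast
    ring
  have hi2 : Integrable fun y : ℝ => 2 * completedRiemannZeta (b + (2 * y : ℝ) * I) :=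
    (hi.comp_mul_left' two_ne_zero).const_mul 2
  have hinv := mellinInv_mellin_eq (b / 2) f one_pos (by simpa using (hM 0).1)
    (by
      refine hi2.congr (Eventually.of_forall fun y => ?_)
      exact (hM y).2.symm) ?_
  · have e : f 1 = ((cosKernel 0 1 - 1 : ℝ) : ℂ) := by
      rw [hf, ← evenKernel_eq_cosKernel_of_zero]
      simp [hurwitzEvenFEPair]
    rw [e, mellinInv] at hinv
    simp only [(hM _).2, ofReal_one, one_cpow, one_smul] at hinv
    rw [integral_const_mul, Measure.integral_comp_mul_left
      (fun y : ℝ => completedRiemannZeta (b + (y : ℝ) * I)) 2] at hinv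
    have hpi : (Real.pi : ℂ) ≠ 0 := by exact_mod_cast Real.pi_ne_zero
    rw [← hinv]
    generalize ∫ y : ℝ, completedRiemannZeta (b + y * I) = K
    simp
    field_simp
  · refine ContinuousAt.sub ?_ continuousAt_const
    exact continuous_ofReal.continuousAt.comp
      ((continuousOn_evenKernel 0).continuousAt (Ioi_mem_nhds one_pos))

/-- As `ξ(u)/(u(u-1))` is half the completed zeta function, Mellin inversion gives `cauchyXi 1 b -
cauchyXi 0 b`. The symmetry `cauchyXi 0 (1-b) = -cauchyXi 1 b` and the jump `2π ξ(0) = π` at `0`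
then determine `cauchyXi 1 b`. -/
theorem cauchyXi_one_of_one_lt {b : ℝ} (hb : 1 < b) : cauchyXi 1 b = Real.pi * A := by
  have h1 := integrable_cauchyXi (a := 1) (b := b) (by simpa using hb.ne')
  have h0 := integrable_cauchyXi (a := 0) (b := b) (by simp; linarith)
  have hpt : ∀ y : ℝ, riemannXi (b + y * I) / (b + y * I - 1) -
      riemannXi (b + y * I) / (b + y * I - 0) = 1 / 2 * completedRiemannZeta (b + y * I) := by
    intro y
    have n1 := line_sub_ne_zero (a := 1) (b := b) (by simpa using hb.ne') y
    have n0 := line_sub_ne_zero (a := 0) (b := b) (by simp; linarith) y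
    rw [sub_zero] at n0 ⊢
    rw [riemannXi_eq_mul_completedRiemannZeta n0 (sub_ne_zero.mp n1)]
    field_simp
    ring
  have hi : Integrable fun y : ℝ => completedRiemannZeta (b + y * I) := by
    refine ((h1.sub h0).const_mul 2).congr (Eventually.of_forall fun y => ?_)
    simp only [Pi.sub_apply, hpt]
    ring
  have hsub : cauchyXi 1 b - cauchyXi 0 b = Real.pi * (cosKernel 0 1 - 1 : ℝ) := by
    rw [cauchyXi, cauchyXi, ← integral_sub h1 h0]
    simp only [hpt]
    rw [integral_const_mul, integral_completedRiemannZeta hb hi]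
    ring
  have hsym := cauchyXi_one_sub 1 b
  rw [sub_self] at hsym
  have hcross := cauchyXi_sub_cauchyXi (a := 0) (b₁ := 1 - b) (b₂ := b) (by simpa using hb)
    (by simp; linarith)
  rw [← riemannXi_one_sub, sub_zero, riemannXi_one] at hcross
  rw [theta_one] at hsub
  push_cast at hsub
  linear_combination (1 / 2 : ℂ) * hsub + (1 / 2 : ℂ) * hcross + (1 / 2 : ℂ) * hsym

theorem cauchyXi_one_of_lt_one {b : ℝ} (hb : b < 1) : cauchyXi 1 b = Real.pi * (A - 1) := by
  have h := cauchyXi_sub_cauchyXi (a := 1) (b₁ := b) (b₂ := 2) (by simpa using hb) (by simp)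
  rw [cauchyXi_one_of_one_lt (by norm_num), riemannXi_one] at h
  linear_combination -h

end XiContour

/-! ### Partial fractions of the kernel, comparison with `J`, residues. -/

namespace XiContour

open Complex Filter Topology Set MeasureTheory

/-- The partial fraction form of the kernel. -/
theorem kernel_eq {s w : ℂ} (hΓ : Complex.Gamma (-w) ≠ 0) (h1 : w ≠ -3 / 2)
    (h2 : w ≠ -s / 2 - 1) (h3 : w ≠ (s - 3) / 2) :
    kernel s w = I / Real.pi * riemannXi (-2 * w - 2) *
      (2 / (-2 * w - 2 - 1) - 1 / (-2 * w - 2 - s) - 1 / (-2 * w - 2 - (1 - s))) := by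
  have n1 : 2 * w + 3 ≠ 0 := fun h => h1 (by linear_combination h / 2)
  have n2 : s + 2 + 2 * w ≠ 0 := fun h => h2 (by linear_combination h / 2)
  have n3 : -3 + s - 2 * w ≠ 0 := fun h => h3 (by linear_combination -h / 2)
  have hu : -2 * w - 2 ≠ 1 := fun h => n1 (by linear_combination -h)
  have hpi : (Real.pi : ℂ) ≠ 0 := by exact_mod_cast Real.pi_ne_zero
  have eΓ : 1 + (-2 * w - 2) / 2 = -w := by ring
  rw [← xiProduct_eq_riemannXi hu (by rwa [eΓ]), xiProduct, eΓ,
    show -(-2 * w - 2) / 2 = w + 1 by ring, Complex.cpow_add _ _ hpi, Complex.cpow_one, kernel]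
  generalize Complex.Gamma (-w) = g
  generalize (Real.pi : ℂ) ^ w = q
  generalize riemannZeta (-2 * w - 2) = z
  rw [show -2 * w - 2 - 1 = -(2 * w + 3) by ring, show -2 * w - 2 - s = -(s + 2 + 2 * w) by ring,
    show -2 * w - 2 - (1 - s) = -3 + s - 2 * w by ring,
    show s / 2 + 1 + w = (s + 2 + 2 * w) / 2 by ring]
  field_simp
  ring

theorem Gamma_neg_ne_zero_of_im_ne_zero {w : ℂ} (hw : w.im ≠ 0) : Complex.Gamma (-w) ≠ 0 := by
  refine Complex.Gamma_ne_zero fun m h => hw ?_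
  simpa using congrArg im h

section Line

variable {s : ℂ} {c : ℝ}

theorem kernel_mul_I_ae_eq (h1 : c ≠ -3 / 2) (h2 : c ≠ -s.re / 2 - 1) (h3 : c ≠ s.re / 2 - 3 / 2) :
    (fun v : ℝ => kernel s (c + I * v) * I) =ᵐ[volume] fun v : ℝ =>
      -(1 / Real.pi : ℂ) * (2 * (riemannXi ((-2 * c - 2 : ℝ) + (-2 * v : ℝ) * I) /
          ((-2 * c - 2 : ℝ) + (-2 * v : ℝ) * I - 1)) -
        riemannXi ((-2 * c - 2 : ℝ) + (-2 * v : ℝ) * I) /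
          ((-2 * c - 2 : ℝ) + (-2 * v : ℝ) * I - s) -
        riemannXi ((-2 * c - 2 : ℝ) + (-2 * v : ℝ) * I) /
          ((-2 * c - 2 : ℝ) + (-2 * v : ℝ) * I - (1 - s))) := by
  -- If `c` is a nonnegative integer, `v = 0` meets a pole of `Γ(-w)`, where the default value of
  -- `Complex.Gamma` invalidates `kernel_eq`.
  have h0 : ∀ᵐ v : ℝ, v ≠ 0 := by simp [ae_iff, measure_singleton]
  filter_upwards [h0] with v hv
  rw [kernel_eq (Gamma_neg_ne_zero_of_im_ne_zero (by simpa using hv))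
    (fun h => h1 (by simpa using congrArg re h)) (fun h => h2 (by simpa using congrArg re h))
    (fun h => h3 (by simpa [sub_div] using congrArg re h))]
  have e : -2 * (c + I * v : ℂ) - 2 = (-2 * c - 2 : ℝ) + (-2 * v : ℝ) * I := by
    push_cast
    ring
  rw [e]
  linear_combination (1 / Real.pi * riemannXi ((-2 * c - 2 : ℝ) + (-2 * v : ℝ) * I) *
    (2 / ((-2 * c - 2 : ℝ) + (-2 * v : ℝ) * I - 1) - 1 / ((-2 * c - 2 : ℝ) + (-2 * v : ℝ) * I - s) -
      1 / ((-2 * c - 2 : ℝ) + (-2 * v : ℝ) * I - (1 - s)))) * I_sq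

theorem integrable_kernel (h1 : c ≠ -3 / 2) (h2 : c ≠ -s.re / 2 - 1) (h3 : c ≠ s.re / 2 - 3 / 2) :
    Integrable fun v : ℝ => kernel s (c + I * v) * I := by
  refine Integrable.congr ?_ (kernel_mul_I_ae_eq h1 h2 h3).symm
  have i1 := (integrable_cauchyXi (a := 1) (b := -2 * c - 2)
    fun h => h1 (by simp at h; linarith)).comp_mul_left' (show (-2 : ℝ) ≠ 0 by norm_num)
  have i2 := (integrable_cauchyXi (a := s) (b := -2 * c - 2)
    fun h => h2 (by linarith)).comp_mul_left' (show (-2 : ℝ) ≠ 0 by norm_num)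
  have i3 := (integrable_cauchyXi (a := 1 - s) (b := -2 * c - 2)
    fun h => h3 (by simp at h; linarith)).comp_mul_left' (show (-2 : ℝ) ≠ 0 by norm_num)
  exact (((i1.const_mul 2).sub i2).sub i3).const_mul _

theorem contourIntegral_eq (h1 : c ≠ -3 / 2) (h2 : c ≠ -s.re / 2 - 1)
    (h3 : c ≠ s.re / 2 - 3 / 2) :
    contourIntegral s c = -(1 / (2 * Real.pi) : ℂ) * (2 * cauchyXi 1 (-2 * c - 2) -
      cauchyXi s (-2 * c - 2) - cauchyXi (1 - s) (-2 * c - 2)) := by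
  have i1 := integrable_cauchyXi (a := 1) (b := -2 * c - 2) fun h => h1 (by simp at h; linarith)
  have i2 := integrable_cauchyXi (a := s) (b := -2 * c - 2) fun h => h2 (by linarith)
  have i3 := integrable_cauchyXi (a := 1 - s) (b := -2 * c - 2)
    fun h => h3 (by simp at h; linarith)
  have e := integral_sub ((i1.const_mul 2).sub i2) i3
  simp only [Pi.sub_apply] at e
  rw [integral_sub (i1.const_mul 2) i2, integral_const_mul] at e
  rw [contourIntegral, integral_congr_ae (kernel_mul_I_ae_eq h1 h2 h3), integral_const_mul,
    Measure.integral_comp_mul_left (fun y : ℝ =>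
      2 * (riemannXi ((-2 * c - 2 : ℝ) + (y : ℝ) * I) / ((-2 * c - 2 : ℝ) + (y : ℝ) * I - 1)) -
        riemannXi ((-2 * c - 2 : ℝ) + (y : ℝ) * I) / ((-2 * c - 2 : ℝ) + (y : ℝ) * I - s) -
        riemannXi ((-2 * c - 2 : ℝ) + (y : ℝ) * I) / ((-2 * c - 2 : ℝ) + (y : ℝ) * I - (1 - s)))
      (-2), e, ← cauchyXi, ← cauchyXi, ← cauchyXi]
  have : |(-2 : ℝ)⁻¹| = 1 / 2 := by rw [abs_of_neg] <;> norm_num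
  rw [this, Complex.real_smul]
  push_cast
  ring

theorem JIntegrand_eq (h2 : c ≠ -s.re / 2 - 1) (h3 : c ≠ s.re / 2 - 3 / 2) (v : ℝ) :
    JIntegrand s c v = -(kernel s (c + I * (-v : ℝ)) * I) := by
  set w : ℂ := c + I * (-v : ℝ) with hw
  have n2 : s + 2 + 2 * w ≠ 0 := fun h => h2 (by
    have := congrArg re h
    simp [hw] at this
    linarith)
  have n3 : -3 + s - 2 * w ≠ 0 := fun h => h3 (by
    have := congrArg re h
    simp [hw] at this
    linarith)
  have ew : (c : ℂ) - I * v = w := by rw [hw]; push_cast; ring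
  have ez : -2 * (c : ℂ) + 2 * I * v - 2 = -2 * w - 2 := by rw [hw]; push_cast; ring
  have eg : -(c : ℂ) + I * v = -w := by rw [hw]; push_cast; ring
  have eM : transferM c s v = (2 * s ^ 2 - 2 * s + 3 + 2 * w) /
      ((s + 2 + 2 * w) * (-3 + s - 2 * w)) := by
    rw [transferM, ← neg_div_neg_eq]
    congr 1
    · rw [hw]
      push_cast
      ring
    · rw [hw]
      push_cast
      ring
  rw [JIntegrand, ew, ez, eg, eM, kernel, show s / 2 + 1 + w = (s + 2 + 2 * w) / 2 by ring]
  generalize Complex.Gamma (-w) = g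
  generalize (Real.pi : ℂ) ^ w = q
  generalize riemannZeta (-2 * w - 2) = z
  have hI : ∀ x y : ℂ, -((2 * I * x - I / 2 * y) * I) = 2 * x - y / 2 := fun x y => by
    linear_combination (y / 2 - 2 * x) * I_sq
  rw [show 2 * I * s * (s - 1 / 2) * (g * q * z / ((-3 + s - 2 * w) * (s + 2 + 2 * w))) =
    2 * I * (s * (s - 1 / 2) * (g * q * z / ((-3 + s - 2 * w) * (s + 2 + 2 * w)))) by ring, hI]
  field_simp
  ring

theorem integrable_JIntegrand (h1 : c ≠ -3 / 2) (h2 : c ≠ -s.re / 2 - 1)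
    (h3 : c ≠ s.re / 2 - 3 / 2) : Integrable (JIntegrand s c) :=
  (integrable_kernel h1 h2 h3).comp_neg.neg.congr
    (Eventually.of_forall fun v => (JIntegrand_eq h2 h3 v).symm)

theorem contourIntegral_eq_neg_J (h2 : c ≠ -s.re / 2 - 1) (h3 : c ≠ s.re / 2 - 3 / 2) :
    contourIntegral s c = -J s c := by
  rw [J, contourIntegral, ← integral_neg, ← integral_neg_eq_self]
  congr 1
  ext v
  rw [JIntegrand_eq h2 h3, neg_neg]

end Line

theorem hasResidueAt_of_eqOn {f g : ℂ → ℂ} {a : ℂ} {R : ℝ} (hR : 0 < R)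
    (hg : DifferentiableOn ℂ g (Metric.ball a R))
    (hf : ∀ w ∈ Metric.ball a R, w ≠ a → f w = (w - a)⁻¹ * g w) : HasResidueAt f a (g a) := by
  refine ⟨R, hR, ?_, fun r hr hrR => ?_⟩
  · have : DifferentiableOn ℂ (fun w => (w - a)⁻¹ * g w) (Metric.ball a R \ {a}) :=
      DifferentiableOn.mul (DifferentiableOn.inv (by fun_prop) fun w hw => sub_ne_zero.mpr hw.2)
        (hg.mono sdiff_subset)
    exact this.congr fun w hw => hf w hw.1 hw.2
  · have hsub : Metric.closedBall a r ⊆ Metric.ball a R := Metric.closedBall_subset_ball hrR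
    have h := (hg.mono hsub).circleIntegral_sub_inv_smul (Metric.mem_ball_self hr)
    simp only [smul_eq_mul] at h
    rw [← h]
    refine circleIntegral.integral_congr hr.le fun w hw => hf w ?_ ?_
    · exact hsub (Metric.sphere_subset_closedBall hw)
    · exact Metric.ne_of_mem_sphere hw hr.ne'

theorem hasResidueAt_of_partial_fractions {f X : ℂ → ℂ} {p q r α β γ : ℂ} (hX : Differentiable ℂ X)
    (hp : p.re < 0) (hq : p ≠ q) (hr : p ≠ r)
    (hf : ∀ w : ℂ, w.re < 0 → w ≠ p → w ≠ q → w ≠ r →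
      f w = X w * (α / (w - p) + β / (w - q) + γ / (w - r))) :
    HasResidueAt f p (X p * α) := by
  -- The disc avoids the other two poles and stays in `Re w < 0`, away from the poles of `Γ(-w)`.
  set R : ℝ := min (-p.re) (min (dist q p) (dist r p)) with hRdef
  have hR : 0 < R := lt_min (by linarith) (lt_min (dist_pos.mpr hq.symm) (dist_pos.mpr hr.symm))
  have hbq : ∀ w ∈ Metric.ball p R, w ≠ q := by
    rintro w hw rfl
    exact absurd ((min_le_right _ _).trans (min_le_left _ _)) (not_le.mpr (Metric.mem_ball.mp hw))
  have hbr : ∀ w ∈ Metric.ball p R, w ≠ r := by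
    rintro w hw rfl
    exact absurd ((min_le_right _ _).trans (min_le_right _ _)) (not_le.mpr (Metric.mem_ball.mp hw))
  have hbre : ∀ w ∈ Metric.ball p R, w.re < 0 := by
    intro w hw
    have h1 : ‖w - p‖ < -p.re := (mem_ball_iff_norm.mp hw).trans_le (min_le_left _ _)
    have h2 := (re_le_norm (w - p)).trans_lt h1
    rw [sub_re] at h2
    linarith
  have := hasResidueAt_of_eqOn (f := f) (a := p)
    (g := fun w => X w * (α + (w - p) * (β / (w - q) + γ / (w - r)))) hR ?_ ?_
  · simpa using this
  · refine hX.differentiableOn.mul ?_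
    refine DifferentiableOn.const_add _ (DifferentiableOn.mul (by fun_prop) ?_)
    refine DifferentiableOn.add ?_ ?_
    · exact DifferentiableOn.div (by fun_prop) (by fun_prop) fun w hw => sub_ne_zero.mpr (hbq w hw)
    · exact DifferentiableOn.div (by fun_prop) (by fun_prop) fun w hw => sub_ne_zero.mpr (hbr w hw)
  · intro w hw hne
    rw [hf w (hbre w hw) hne (hbq w hw) (hbr w hw)]
    have := sub_ne_zero.mpr hne
    field_simp
    ring

theorem kernel_eq_partial_fractions {s w : ℂ} (hw : w.re < 0) (h1 : w ≠ -3 / 2)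
    (h2 : w ≠ -s / 2 - 1) (h3 : w ≠ (s - 3) / 2) :
    kernel s w = I / (2 * Real.pi) * riemannXi (-2 * w - 2) *
      (-2 / (w - -3 / 2) + 1 / (w - (-s / 2 - 1)) + 1 / (w - (s - 3) / 2)) := by
  rw [kernel_eq (Complex.Gamma_ne_zero_of_re_pos (by simpa using hw)) h1 h2 h3,
    show -2 * w - 2 - 1 = -2 * (w - -3 / 2) by ring,
    show -2 * w - 2 - s = -2 * (w - (-s / 2 - 1)) by ring,
    show -2 * w - 2 - (1 - s) = -2 * (w - (s - 3) / 2) by ring]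
  rw [← sub_ne_zero] at h1 h2 h3
  have hpi : (Real.pi : ℂ) ≠ 0 := by exact_mod_cast Real.pi_ne_zero
  generalize w - -3 / 2 = x at *
  generalize w - (-s / 2 - 1) = y at *
  generalize w - (s - 3) / 2 = z at *
  field_simp
  ring

/-- The defining product of `ξ` at `1 - s`, by `Γ(1 + z) = z Γ(z)` with `z = (1-s)/2`. So for `0 ≤
Re s` this residue equals `resRed s`. -/
theorem resGreen_eq {s : ℂ} (hs : s.re ≤ 1) (h0 : s ≠ 0) (h1 : s ≠ 1) :
    resGreen s = I * riemannXi s / (2 * Real.pi) := by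
  have hpi : (Real.pi : ℂ) ≠ 0 := by exact_mod_cast Real.pi_ne_zero
  have hh : (1 - s) / 2 ≠ 0 := div_ne_zero (sub_ne_zero.mpr h1.symm) two_ne_zero
  have hΓ : Complex.Gamma (1 + (1 - s) / 2) ≠ 0 := by
    refine Complex.Gamma_ne_zero_of_re_pos ?_
    simp
    linarith
  rw [← riemannXi_one_sub, ← xiProduct_eq_riemannXi (fun h => h0 (by linear_combination -h)) hΓ,
    xiProduct, add_comm, Complex.Gamma_add_one _ hh, resGreen,
    show -s / 2 + 1 / 2 = (1 - s) / 2 by ring,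
    show (s - 3) / 2 = -(1 - s) / 2 + -1 by ring, Complex.cpow_add _ _ hpi, Complex.cpow_neg_one]
  field_simp
  ring

theorem resBlue_eq : resBlue = -I / (2 * Real.pi) := by
  have hpi : (Real.pi : ℂ) ≠ 0 := by exact_mod_cast Real.pi_ne_zero
  rw [resBlue]
  field_simp
  simp

theorem two_pi_I_mul_resBlue : 2 * Real.pi * I * resBlue = 1 := by
  have hpi : (Real.pi : ℂ) ≠ 0 := by exact_mod_cast Real.pi_ne_zero
  rw [resBlue]
  field_simp

theorem two_pi_I_mul_I_mul (x : ℂ) : 2 * Real.pi * I * (I * x / (2 * Real.pi)) = -x := by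
  have hpi : (Real.pi : ℂ) ≠ 0 := by exact_mod_cast Real.pi_ne_zero
  field_simp
  simp

end XiContour

/-! ### Values of the contour integral in each region, and the theorem. -/

namespace XiContour

open Complex

/-- By symmetry the sum is `cauchyXi s b - cauchyXi s (1 - b)`, so only the position of `b` and `1 -
b` relative to `Re s` matters, here and in the next two lemmas. -/
theorem cauchyXi_add_of_gt {s : ℂ} {b : ℝ} (h1 : s.re < b) (h2 : 1 - s.re < b) :
    cauchyXi s b + cauchyXi (1 - s) b = 2 * Real.pi * riemannXi s := by
  have hc := cauchyXi_sub_cauchyXi (a := s) (b₁ := 1 - b) (b₂ := b) (by linarith) h1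
  have hs := cauchyXi_one_sub s (1 - b)
  rw [sub_sub_cancel] at hs
  linear_combination hc + hs

theorem cauchyXi_add_of_lt {s : ℂ} {b : ℝ} (h1 : b < s.re) (h2 : b < 1 - s.re) :
    cauchyXi s b + cauchyXi (1 - s) b = -(2 * Real.pi * riemannXi s) := by
  have hc := cauchyXi_sub_cauchyXi (a := s) (b₁ := b) (b₂ := 1 - b) h1 (by linarith)
  have hs := cauchyXi_one_sub s (1 - b)
  rw [sub_sub_cancel] at hs
  linear_combination -hc + hs

theorem cauchyXi_add_of_between {s : ℂ} {b : ℝ}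
    (h : s.re < b ∧ b < 1 - s.re ∨ b < s.re ∧ 1 - s.re < b) :
    cauchyXi s b + cauchyXi (1 - s) b = 0 := by
  have hc := cauchyXi_eq_of_same_side (a := s) (b₁ := b) (b₂ := 1 - b)
    (h.imp (fun h => ⟨h.1, by linarith [h.2]⟩) fun h => ⟨h.1, by linarith [h.2]⟩)
  have hs := cauchyXi_one_sub s (1 - b)
  rw [sub_sub_cancel] at hs
  linear_combination hc + hs

section Regions

variable {s : ℂ} {c : ℝ}

theorem contourIntegral_of_lt (hs0 : 0 ≤ s.re) (hs1 : s.re ≤ 1) (hc : c < -3 / 2) :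
    contourIntegral s c = riemannXi s - A := by
  have hpi : (Real.pi : ℂ) ≠ 0 := by exact_mod_cast Real.pi_ne_zero
  rw [contourIntegral_eq hc.ne (by linarith) (by linarith), cauchyXi_one_of_one_lt (by linarith),
    sub_sub, cauchyXi_add_of_gt (by linarith) (by linarith)]
  field_simp
  ring

theorem contourIntegral_of_mem_regionII (h : (s.re, c) ∈ regionII) :
    contourIntegral s c = riemannXi s - A + 1 := by
  obtain ⟨-, -, h1, h2, h3⟩ := h
  simp only at h1 h2 h3
  have hpi : (Real.pi : ℂ) ≠ 0 := by exact_mod_cast Real.pi_ne_zero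
  rw [contourIntegral_eq h1.ne' h2.ne h3.ne, cauchyXi_one_of_lt_one (by linarith),
    sub_sub, cauchyXi_add_of_gt (by linarith) (by linarith)]
  field_simp
  ring

theorem contourIntegral_of_mem_regionIII_union_regionV (h : (s.re, c) ∈ regionIII ∪ regionV) :
    contourIntegral s c = 1 - A := by
  have hpi : (Real.pi : ℂ) ≠ 0 := by exact_mod_cast Real.pi_ne_zero
  rcases h with ⟨-, -, h1, h2, h3⟩ | ⟨-, -, h1, h2, h3⟩ <;> simp only at h1 h2 h3
  · rw [contourIntegral_eq h1.ne' h2.ne' h3.ne, cauchyXi_one_of_lt_one (by linarith),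
      sub_sub, cauchyXi_add_of_between (Or.inr ⟨by linarith, by linarith⟩)]
    field_simp
    ring
  · rw [contourIntegral_eq h1.ne' h2.ne h3.ne', cauchyXi_one_of_lt_one (by linarith),
      sub_sub, cauchyXi_add_of_between (Or.inl ⟨by linarith, by linarith⟩)]
    field_simp
    ring

theorem contourIntegral_of_mem_regionIV (h : (s.re, c) ∈ regionIV) :
    contourIntegral s c = -riemannXi s - A + 1 := by
  obtain ⟨-, -, h1, h2, h3⟩ := h
  simp only at h1 h2 h3
  have hpi : (Real.pi : ℂ) ≠ 0 := by exact_mod_cast Real.pi_ne_zero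
  rw [contourIntegral_eq h1.ne' h2.ne' h3.ne', cauchyXi_one_of_lt_one (by linarith),
    sub_sub, cauchyXi_add_of_lt (by linarith) (by linarith)]
  field_simp
  ring

end Regions

theorem hasResidueAt_kernel {s : ℂ} (hs0 : 0 ≤ s.re) (hs1 : s.re ≤ 1) (h0 : s ≠ 0)
    (hh : s ≠ 1 / 2) (h1 : s ≠ 1) :
    HasResidueAt (kernel s) (-3 / 2) resBlue ∧
      HasResidueAt (kernel s) (-s / 2 - 1) (resRed s) ∧
      HasResidueAt (kernel s) ((s - 3) / 2) (resGreen s) := by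
  have hX : Differentiable ℂ fun w : ℂ => I / (2 * Real.pi) * riemannXi (-2 * w - 2) := by
    have := differentiable_riemannXi
    fun_prop
  have n12 : (-3 / 2 : ℂ) ≠ -s / 2 - 1 := fun h => h1 (by linear_combination 2 * h)
  have n13 : (-3 / 2 : ℂ) ≠ (s - 3) / 2 := fun h => h0 (by linear_combination -2 * h)
  have n23 : -s / 2 - 1 ≠ (s - 3) / 2 := fun h => hh (by linear_combination -h)
  have hk := fun w => @kernel_eq_partial_fractions s w
  refine ⟨?_, ?_, ?_⟩
  · have := hasResidueAt_of_partial_fractions (f := kernel s) (α := -2) (β := 1) (γ := 1) hX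
      (by norm_num) n12 n13 fun w hw a b d => hk w hw a b d
    convert! this using 1
    rw [resBlue_eq, show (-2 * (-3 / 2) - 2 : ℂ) = 1 by norm_num, riemannXi_one]
    ring
  · have := hasResidueAt_of_partial_fractions (f := kernel s) (α := 1) (β := -2) (γ := 1) hX
      (by simp; linarith) n12.symm n23 fun w hw b a d => by rw [hk w hw a b d]; ring
    convert! this using 1
    rw [resRed, xi_eq_riemannXi hs0, show -2 * (-s / 2 - 1) - 2 = s by ring]
    ring
  · have := hasResidueAt_of_partial_fractions (f := kernel s) (α := 1) (β := -2) (γ := 1) hX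
      (by simp; linarith) n13.symm n23.symm fun w hw d a b => by rw [hk w hw a b d]; ring
    convert! this using 1
    rw [resGreen_eq hs1 h0 h1, show -2 * ((s - 3) / 2) - 2 = 1 - s by ring, riemannXi_one_sub]
    ring

end XiContour

theorem mainTheorem2 (s : ℂ) (hs0 : 0 ≤ s.re) (hs1 : s.re ≤ 1) :
    -- `J(s, c)` converges off the pole lines, where it is minus the contour integral
    (∀ c : ℝ, c ≠ -3 / 2 → c ≠ -s.re / 2 - 1 → c ≠ s.re / 2 - 3 / 2 →
      MeasureTheory.Integrable (XiContour.JIntegrand s c) ∧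
      XiContour.contourIntegral s c = -XiContour.J s c) ∧
    -- the residues, and their subtraction as the contour is shifted (three distinct poles)
    (s ≠ 0 → s ≠ 1 / 2 → s ≠ 1 →
      XiContour.HasResidueAt (XiContour.kernel s) (-3 / 2) XiContour.resBlue ∧
      XiContour.HasResidueAt (XiContour.kernel s) (-s / 2 - 1) (XiContour.resRed s) ∧
      XiContour.HasResidueAt (XiContour.kernel s) ((s - 3) / 2) (XiContour.resGreen s) ∧
      ∀ c₁ c : ℝ, c₁ < -3 / 2 →
        ((s.re, c) ∈ XiContour.regionII →
          XiContour.contourIntegral s c₁ = XiContour.contourIntegral s c -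
            2 * Real.pi * Complex.I * XiContour.resBlue) ∧
        ((s.re, c) ∈ XiContour.regionIII →
          XiContour.contourIntegral s c₁ = XiContour.contourIntegral s c -
            2 * Real.pi * Complex.I * (XiContour.resBlue + XiContour.resRed s)) ∧
        ((s.re, c) ∈ XiContour.regionV →
          XiContour.contourIntegral s c₁ = XiContour.contourIntegral s c -
            2 * Real.pi * Complex.I * (XiContour.resBlue + XiContour.resGreen s)) ∧
        ((s.re, c) ∈ XiContour.regionIV →
          XiContour.contourIntegral s c₁ = XiContour.contourIntegral s c -
            2 * Real.pi * Complex.I *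
              (XiContour.resBlue + XiContour.resRed s + XiContour.resGreen s))) ∧
    -- the resulting representations
    (∀ c : ℝ,
      ((s.re, c) ∈ XiContour.regionII →
        XiContour.xi s = XiContour.A - 1 - XiContour.J s c) ∧
      ((s.re, c) ∈ XiContour.regionIII ∪ XiContour.regionV →
        0 = XiContour.A - 1 - XiContour.J s c) ∧
      ((s.re, c) ∈ XiContour.regionIV →
        -XiContour.xi s = XiContour.A - 1 - XiContour.J s c)) := by
  refine ⟨fun c h1 h2 h3 => ⟨XiContour.integrable_JIntegrand h1 h2 h3,
    XiContour.contourIntegral_eq_neg_J h2 h3⟩, fun h0 hh h1 => ?_, fun c => ?_⟩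
  · obtain ⟨r1, r2, r3⟩ := XiContour.hasResidueAt_kernel hs0 hs1 h0 hh h1
    have hred := XiContour.two_pi_I_mul_I_mul (XiContour.riemannXi s)
    have hgreen := XiContour.two_pi_I_mul_I_mul (XiContour.riemannXi s)
    rw [← XiContour.resGreen_eq hs1 h0 h1] at hgreen
    rw [← XiContour.xi_eq_riemannXi hs0, ← XiContour.resRed, XiContour.xi_eq_riemannXi hs0] at hred
    have hblue := XiContour.two_pi_I_mul_resBlue
    refine ⟨r1, r2, r3, fun c₁ c hc₁ => ?_⟩
    -- Here `-2c₁ - 2 > 1`, so the line in `u` is to the right of all three poles and the value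
    -- `ξ(s) - A` does not depend on `c₁`.
    rw [XiContour.contourIntegral_of_lt hs0 hs1 hc₁]
    refine ⟨fun h => ?_, fun h => ?_, fun h => ?_, fun h => ?_⟩
    · rw [XiContour.contourIntegral_of_mem_regionII h]
      linear_combination hblue
    · rw [XiContour.contourIntegral_of_mem_regionIII_union_regionV (Or.inl h)]
      linear_combination hblue + hred
    · rw [XiContour.contourIntegral_of_mem_regionIII_union_regionV (Or.inr h)]
      linear_combination hblue + hgreen
    · rw [XiContour.contourIntegral_of_mem_regionIV h]
      linear_combination hblue + hred + hgreen
  · rw [XiContour.xi_eq_riemannXi hs0]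
    refine ⟨fun h => ?_, fun h => ?_, fun h => ?_⟩
    · have hJ := XiContour.contourIntegral_eq_neg_J h.2.2.2.1.ne h.2.2.2.2.ne
      rw [XiContour.contourIntegral_of_mem_regionII h] at hJ
      linear_combination hJ
    · have hJ : XiContour.contourIntegral s c = -XiContour.J s c := by
        rcases h with h | h
        · exact XiContour.contourIntegral_eq_neg_J h.2.2.2.1.ne' h.2.2.2.2.ne
        · exact XiContour.contourIntegral_eq_neg_J h.2.2.2.1.ne h.2.2.2.2.ne'
      rw [XiContour.contourIntegral_of_mem_regionIII_union_regionV h] at hJ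
      linear_combination hJ
    · have hJ := XiContour.contourIntegral_eq_neg_J h.2.2.2.1.ne' h.2.2.2.2.ne'
      rw [XiContour.contourIntegral_of_mem_regionIV h] at hJ
      linear_combination hJ
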